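/- Let $G$ be the simple, simply connected complex algebraic group of type $E_6$ (Bourbaki labelling), with Chevalley generators $e_i,f_i,h_i$, one-parameter subgroups $x_i(a)=\exp(ae_i)$, $y_i(a)=\exp(af_i)$, transposition anti-automorphism $x_i(a)^T=y_i(a)$, and Weyl group $W=\langle s_1,\dots,s_6\rangle$. Put $\bar s_i=x_i(-1)y_i(1)x_i(-1)$ and $\bar w=\bar s_{i_1}\cdots\bar s_{i_d}$ for a reduced expression $w=s_{i_1}\cdots s_{i_d}$. Let $V(\omega_i)$ be the $i$-th fundamental representation, $v^+_{\omega_i}$ a highest weight vector, $\langle u,v^+_{\omega_i}\rangle$ the coefficient of $v^+_{\omega_i}$ in the projection of $u$ to the highest weight space along the other weight spaces, and $$\Delta_{w_1(\omega_i),w_2(\omega_i)}(g)=\langle \bar w_1^{-1}\,g\,\bar w_2\, v^+_{\omega_i},v^+_{\omega_i}\rangle .$$ Let $\sigma$ be the symmetry of the Dynkin diagram ($1\leftrightarrow 6$, $3\leftrightarrow5$, $2,4$ fixed), $w_0$ the longest element of $W$, and $$\Delta^T_{w_1(\omega_i),w_2(\omega_i)}(g)=\Delta_{w_2w_0(\omega_{\sigma(i)}),\,w_1w_0(\omega_{\sigma(i)})}(g^T).$$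 *Plücker coordinates.* The minuscule representation $V(\omega_1)$ has a basis of 27 weight vectors $v_0,\dots,v_{16}$ (highest weight vector $v_{16}$, lowest weight vector $v_0$) in which $f_i$ and $e_i$ act through the weight diagram: $v\xrightarrow{\,i\,}w$ means $f_iv=w$, $e_iw=v$, and all other products are $0$. The edges are $v_{16}\xrightarrow{1}v_{15}\xrightarrow{3}v_{14}\xrightarrow{4}v_{13}$, $v_{13}\xrightarrow{2}v_{12}'$, $v_{13}\xrightarrow{5}v_{12}''$, $v_{12}'\xrightarrow{5}v_{11}'$, $v_{12}''\xrightarrow{2}v_{11}'$, $v_{12}''\xrightarrow{6}v_{11}''$, $v_{11}'\xrightarrow{4}v_{10}'$, $v_{11}'\xrightarrow{6}v_{10}''$, $v_{11}''\xrightarrow{2}v_{10}''$, $v_{10}'\xrightarrow{3}v_9'$, $v_{10}'\xrightarrow{6}v_9''$, $v_{10}''\xrightarrow{4}v_9''$, $v_9'\xrightarrow{1}v_8$, $v_9'\xrightarrow{6}v_8'$, $v_9''\xrightarrow{3}v_8'$, $v_9''\xrightarrow{5}v_8''$, $v_8\xrightarrow{6}v_7'$, $v_8'\xrightarrow{1}v_7'$,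 $v_8'\xrightarrow{5}v_7''$, $v_8''\xrightarrow{3}v_7''$, $v_7'\xrightarrow{5}v_6'$, $v_7''\xrightarrow{1}v_6'$, $v_7''\xrightarrow{4}v_6''$, $v_6'\xrightarrow{4}v_5'$, $v_6''\xrightarrow{1}v_5'$, $v_6''\xrightarrow{2}v_5''$, $v_5'\xrightarrow{3}v_4'$, $v_5'\xrightarrow{2}v_4''$, $v_5''\xrightarrow{1}v_4''$, $v_4'\xrightarrow{2}v_3$, $v_4''\xrightarrow{3}v_3$, $v_3\xrightarrow{4}v_2\xrightarrow{5}v_1\xrightarrow{6}v_0$. Put $p_j^{(k)}(g)=v_0^*(g\,v_j^{(k)})$, where $(k)$ stands for the primes, and \begin{align*} q_8&=p_1p_7'-p_0p_8,\qquad q_8'=p_2p_6'-p_1p_7'+p_0p_8,\qquad q_{10}=p_2p_8''-p_1p_9''+p_0p_{10}',\\ q_{15}&=p_6'(p_1p_8'-p_0p_9')-p_7''(p_1p_7'-p_0p_8),\\ q_{12}&=p_1p_{11}''-p_0p_{12}'',\qquad q_{16}=p_7'p_9'-p_8p_8',\qquad q_{20}=p_5''p_{15}-p_4''p_{16},\\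 q_{24}&=p_0(p_{11}'p_{13}-p_{12}'p_{12}'')-p_1(p_{10}''p_{13}-p_{11}''p_{12}')+p_2(p_{10}''p_{12}''-p_{11}'p_{11}''). \end{align*} *Initial seed.* Write $w_0=s_{r_{36}}\cdots s_{r_1}$ for the reduced expression whose indices, read from left to right, are $1,2,3,1,4,3,1,2,4,3,5,4,2,3,4,5,1,3,4,2,\;6,5,4,2,3,4,5,6,1,3,4,5,2,4,3,1.$ For $m\le 36$ put $u_{\ge m}=s_{r_{36}}\cdots s_{r_m}$ and $\phi(m,\omega_{r_m})=\Delta^T_{u_{\ge m}(\omega_{r_m}),w_0(\omega_{r_m})}$; also $r_{42}=6$, $u_{\ge 42}=e$, and $\phi(42,\omega_6)=\Delta^T_{\omega_6,w_0(\omega_6)}$. An index $m\le 36$ is exchangeable if $r_l=r_m$ for some $1\le l<m$. The mutable variables are $\phi(m,\omega_{r_m})$ for $m\le16$ exchangeable; the frozen ones are $\phi(t_i,\omega_i)$, where $t_i=\min\{t>16: r_t=i\}$ for $i\ne 6$ and $t_6=42$, and $\Delta^T_{\omega_6,\omega_6}$. For an index $m$ let $m^+$ be the largest $l<m$ with $1\le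 l\le 36$ and $r_l=r_m$. The quiver has these variables as vertices. For indices $m>l$ of variables, at least one of them mutable, it has an arrow $m\to l$ iff $m^+=l$, and an arrow $l\to m$ iff $l>m^+>l^+$ and the Cartan integer $a_{r_m,r_l}$ is negative. In addition it has one arrow from $\Delta^T_{\omega_6,\omega_6}$ to the index $m$ which is the second smallest one with $r_m=\sigma(6)=1$. **Lemma.** The indices of the mutable variables are $6,7,8,10,11,12,13,14,15,16$, and $(t_1,\dots,t_6)=(20,17,19,18,21,42)$. On the torus $U_-^\circ=\{y_{r_{16}}(a_{16})\cdots y_{r_1}(a_1): a_i\in\mathbb C^*\}\subset G$ the mutable variables are $$\begin{aligned} &\phi(6,\omega_4)=p_3,\ \phi(7,\omega_3)=p_2,\ \phi(8,\omega_1)=p_1,\ \phi(10,\omega_5)=p_4'',\ \phi(11,\omega_4)=q_8',\\ &\phi(12,\omega_3)=q_8,\ \phi(13,\omega_2)=p_4',\ \phi(14,\omega_4)=q_{15},\ \phi(15,\omega_5)=q_{10},\ \phi(16,\omega_6)=p_5'', \end{aligned}$$ and the frozen variables are $$\begin{aligned} &\phi(17,\omega_2)=q_{12},\ \phi(18,\omega_4)=q_{24},\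 \phi(19,\omega_3)=q_{16},\ \phi(20,\omega_1)=p_8,\\ &\phi(21,\omega_5)=q_{20},\ \phi(42,\omega_6)=p_{16},\ \Delta^T_{\omega_6,\omega_6}=\Delta_{\omega_6,\omega_6}=p_0 . \end{aligned}$$ With the vertices labelled by these expressions, the arrows of the quiver are exactly $p_8\to p_1$; $q_{12}\to p_4'$; $q_{16}\to q_8\to p_2$; $q_{24}\to q_{15}\to q_8'\to p_3$; $q_{20}\to q_{10}\to p_4''$; $p_{16}\to p_5''$; $p_1\to q_8$; $p_2\to q_8'$; $p_4'\to q_{15}$; $p_5''\to q_{20}$; $q_{10}\to q_{24}$; $p_3\to p_4'$; $p_3\to p_4''$; $p_4''\to q_8'$; $p_4''\to p_5''$; $q_8'\to q_8$; $q_8'\to q_{10}$; $q_8\to p_8$; $q_8\to q_{15}$; $q_{15}\to q_{16}$; $q_{15}\to q_{12}$; $p_0\to p_1$. -/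

import Mathlib

namespace CayleyPlane

noncomputable section

/-! ### The root datum of type `E₆` -/

/-- The node of the Dynkin diagram of type `E₆` with Bourbaki label `i` (for `1 ≤ i ≤ 6`). -/
def node (i : ℕ) : Fin 6 := Fin.ofNat 6 (i - 1)

/-- The symmetry of the Dynkin diagram of type `E₆`: it exchanges `1 ↔ 6` and `3 ↔ 5` and fixes
`2` and `4`.  The longest Weyl group element maps `ω_i` to `-ω_{σ(i)}`. -/
def dynkinSymm : Fin 6 → Fin 6 := ![5, 1, 4, 3, 2, 0]

/-- The simple reflection `s_i` as an integral matrix acting on weights written in the basis of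
fundamental weights: `s_i(μ) = μ - μ_i α_i`, where `α_i` has coordinates `(A_{ji})_j`. -/
def simpleReflection (i : Fin 6) : Matrix (Fin 6) (Fin 6) ℤ :=
  1 - Matrix.of fun j k => if k = i then CartanMatrix.E₆ j i else 0

/-- The Weyl group element `s_{i_1} ⋯ s_{i_d}`. -/
def weylProd (l : List (Fin 6)) : Matrix (Fin 6) (Fin 6) ℤ := (l.map simpleReflection).prod

/-- `l` is a reduced expression for the Weyl group element `w`: an expression as a product of
simple reflections, of minimal length. -/
def IsReducedExpr (l : List (Fin 6)) (w : Matrix (Fin 6) (Fin 6) ℤ) : Prop :=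
  weylProd l = w ∧ ∀ l' : List (Fin 6), weylProd l' = w → l.length ≤ l'.length

/-! ### The simply connected group of type `E₆` -/

/-- The exponential series of a nilpotent element (a finite sum). -/
def expo {A : Type*} [Ring A] [Algebra ℂ A] (T : A) : A :=
  ∑ᶠ k : ℕ, ((k.factorial : ℂ)⁻¹) • T ^ k

theorem expo_of_sq_eq_zero {A : Type*} [Ring A] [Algebra ℂ A] {T : A} (hT : T * T = 0) :
    expo T = 1 + T := by
  have hsub : (Function.support fun k : ℕ => ((k.factorial : ℂ)⁻¹) • T ^ k) ⊆
      ((Finset.range 2 : Finset ℕ) : Set ℕ) := by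
    intro k hk
    by_contra h
    have hk2 : 2 ≤ k := not_lt.mp fun hlt => h (by simpa using hlt)
    apply hk
    obtain ⟨m, rfl⟩ := Nat.exists_eq_add_of_le hk2
    simp [pow_add, pow_two, hT]
  rw [expo, finsum_eq_sum_of_support_subset _ hsub]
  simp [Finset.sum_range_succ]

/-- The 27 weights of the minuscule representation `V(ω₁)`.  A letter `a` stands for one prime and
a letter `b` for two primes, so that `v4a` is `v₄'` and `v4b` is `v₄''`. -/
inductive PWt
  | v0 | v1 | v2 | v3 | v4a | v4b | v5a | v5b | v6a | v6b | v7a | v7b | v8 | v8a | v8b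
  | v9a | v9b | v10a | v10b | v11a | v11b | v12a | v12b | v13 | v14 | v15 | v16
  deriving DecidableEq

instance : Fintype PWt where
  elems := {.v0, .v1, .v2, .v3, .v4a, .v4b, .v5a, .v5b, .v6a, .v6b, .v7a, .v7b, .v8, .v8a, .v8b,
    .v9a, .v9b, .v10a, .v10b, .v11a, .v11b, .v12a, .v12b, .v13, .v14, .v15, .v16}
  complete := by intro x; cases x <;> decide

/-- The edges of the weight diagram of `V(ω₁)` (the Hasse diagram of the Cayley plane): a triple
`(v, i, w)` means that `f_i v = w` and `e_i w = v`.  The highest weight vector is `v16`, the lowest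
one is `v0`. -/
def hasseEdges : List (PWt × ℕ × PWt) :=
  [(.v1, 6, .v0), (.v2, 5, .v1), (.v3, 4, .v2), (.v4a, 2, .v3), (.v4b, 3, .v3), (.v5a, 3, .v4a),
   (.v5a, 2, .v4b), (.v5b, 1, .v4b), (.v6a, 4, .v5a), (.v6b, 1, .v5a), (.v6b, 2, .v5b),
   (.v7a, 5, .v6a), (.v7b, 1, .v6a), (.v7b, 4, .v6b), (.v8, 6, .v7a), (.v8a, 1, .v7a),
   (.v8a, 5, .v7b), (.v8b, 3, .v7b), (.v9a, 1, .v8), (.v9a, 6, .v8a), (.v9b, 3, .v8a),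
   (.v9b, 5, .v8b), (.v10a, 3, .v9a), (.v10a, 6, .v9b), (.v10b, 4, .v9b), (.v11a, 4, .v10a),
   (.v11a, 6, .v10b), (.v11b, 2, .v10b), (.v12a, 5, .v11a), (.v12b, 2, .v11a), (.v12b, 6, .v11b),
   (.v13, 2, .v12a), (.v13, 5, .v12b), (.v14, 4, .v13), (.v15, 3, .v14), (.v16, 1, .v15)]

/-- The Chevalley generator `e_i` acting on the minuscule representation `V(ω₁) = ℂ²⁷`. -/
def eMat (i : Fin 6) : Matrix PWt PWt ℂ :=
  Matrix.of fun v w => if (v, (i : ℕ) + 1, w) ∈ hasseEdges then 1 else 0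

/-- The Chevalley generator `f_i` acting on the minuscule representation `V(ω₁) = ℂ²⁷`. -/
def fMat (i : Fin 6) : Matrix PWt PWt ℂ :=
  Matrix.of fun w v => if (v, (i : ℕ) + 1, w) ∈ hasseEdges then 1 else 0

theorem transpose_eMat (i : Fin 6) : (eMat i).transpose = fMat i := rfl

theorem transpose_fMat (i : Fin 6) : (fMat i).transpose = eMat i := rfl

theorem hasseEdges_no_chain :
    ∀ x ∈ hasseEdges, ∀ y ∈ hasseEdges, x.2.1 = y.2.1 → x.2.2 ≠ y.1 := by
  decide

theorem eMat_mul_self (i : Fin 6) : eMat i * eMat i = 0 := by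
  ext v w
  rw [Matrix.mul_apply]
  refine Finset.sum_eq_zero fun u _ => ?_
  simp only [eMat, Matrix.of_apply]
  by_cases h1 : (v, (i : ℕ) + 1, u) ∈ hasseEdges
  · by_cases h2 : (u, (i : ℕ) + 1, w) ∈ hasseEdges
    · exact absurd rfl (hasseEdges_no_chain _ h1 _ h2 rfl)
    · simp [h2]
  · simp [h1]

theorem fMat_mul_self (i : Fin 6) : fMat i * fMat i = 0 := by
  rw [← transpose_eMat, ← Matrix.transpose_mul, eMat_mul_self, Matrix.transpose_zero]

theorem expo_mul_expo_neg {A : Type*} [Ring A] [Algebra ℂ A] {T : A} (hT : T * T = 0) (a : ℂ) :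
    expo (a • T) * expo (-a • T) = 1 := by
  have h : ∀ b : ℂ, expo (b • T) = 1 + b • T := fun b =>
    expo_of_sq_eq_zero (by simp [hT])
  rw [h, h]
  simp [mul_add, add_mul, hT]

theorem expo_neg_mul_expo {A : Type*} [Ring A] [Algebra ℂ A] {T : A} (hT : T * T = 0) (a : ℂ) :
    expo (-a • T) * expo (a • T) = 1 := by
  simpa using expo_mul_expo_neg hT (-a)

/-- The one-parameter subgroup `a ↦ exp(a e_i)` of `GL(V(ω₁))`. -/
def xGL (i : Fin 6) (a : ℂ) : (Matrix PWt PWt ℂ)ˣ where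
  val := expo (a • eMat i)
  inv := expo (-a • eMat i)
  val_inv := expo_mul_expo_neg (eMat_mul_self i) a
  inv_val := expo_neg_mul_expo (eMat_mul_self i) a

/-- The one-parameter subgroup `a ↦ exp(a f_i)` of `GL(V(ω₁))`. -/
def yGL (i : Fin 6) (a : ℂ) : (Matrix PWt PWt ℂ)ˣ where
  val := expo (a • fMat i)
  inv := expo (-a • fMat i)
  val_inv := expo_mul_expo_neg (fMat_mul_self i) a
  inv_val := expo_neg_mul_expo (fMat_mul_self i) a

/-- The simple and simply connected complex algebraic group of type `E₆`, as the Chevalley group of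
the faithful representation `V(ω₁)`: the subgroup of `GL₂₇(ℂ)` that is generated by the
one-parameter subgroups `exp(a e_i)` and `exp(a f_i)`. -/
def G : Subgroup (Matrix PWt PWt ℂ)ˣ :=
  Subgroup.closure {g | ∃ (i : Fin 6) (a : ℂ), g = xGL i a ∨ g = yGL i a}

/-- The element `x_i(a) = exp(a e_i)` of `G`. -/
def x (i : Fin 6) (a : ℂ) : G := ⟨xGL i a, Subgroup.subset_closure ⟨i, a, Or.inl rfl⟩⟩

/-- The element `y_i(a) = exp(a f_i)` of `G`. -/
def y (i : Fin 6) (a : ℂ) : G := ⟨yGL i a, Subgroup.subset_closure ⟨i, a, Or.inr rfl⟩⟩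

/-- Transposition of invertible matrices. -/
def transposeGL (g : (Matrix PWt PWt ℂ)ˣ) : (Matrix PWt PWt ℂ)ˣ where
  val := (g : Matrix PWt PWt ℂ).transpose
  inv := ((g⁻¹ : (Matrix PWt PWt ℂ)ˣ) : Matrix PWt PWt ℂ).transpose
  val_inv := by rw [← Matrix.transpose_mul, Units.inv_mul, Matrix.transpose_one]
  inv_val := by rw [← Matrix.transpose_mul, Units.mul_inv, Matrix.transpose_one]

theorem expo_smul_transpose (T : Matrix PWt PWt ℂ) (hT : T * T = 0) (a : ℂ) :
    (expo (a • T)).transpose = expo (a • T.transpose) := by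
  rw [expo_of_sq_eq_zero (by simp [hT]), expo_of_sq_eq_zero]
  · simp
  · rw [← Matrix.transpose_smul, ← Matrix.transpose_mul]
    simp [hT]

theorem transposeGL_xGL (i : Fin 6) (a : ℂ) : transposeGL (xGL i a) = yGL i a :=
  Units.ext (expo_smul_transpose _ (eMat_mul_self i) a)

theorem transposeGL_yGL (i : Fin 6) (a : ℂ) : transposeGL (yGL i a) = xGL i a :=
  Units.ext (expo_smul_transpose _ (fMat_mul_self i) a)

theorem transposeGL_mem (g : (Matrix PWt PWt ℂ)ˣ) (hg : g ∈ G) : transposeGL g ∈ G := by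
  induction hg using Subgroup.closure_induction with
  | mem g hg =>
    obtain ⟨i, a, rfl | rfl⟩ := hg
    · rw [transposeGL_xGL]; exact (y i a).2
    · rw [transposeGL_yGL]; exact (x i a).2
  | one =>
    have h : transposeGL 1 = 1 := Units.ext (by simp [transposeGL])
    rw [h]; exact one_mem _
  | mul g h _ _ hg hh =>
    have e : transposeGL (g * h) = transposeGL h * transposeGL g :=
      Units.ext (by simp [transposeGL, Matrix.transpose_mul])
    rw [e]; exact mul_mem hh hg
  | inv g _ hg =>
    have e : transposeGL g⁻¹ = (transposeGL g)⁻¹ := Units.ext rfl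
    rw [e]; exact inv_mem hg

/-- The transposition anti-automorphism `g ↦ g^T` of `G`; it exchanges `x_i(a)` and `y_i(a)`. -/
def transpose (g : G) : G := ⟨transposeGL g, transposeGL_mem g g.2⟩

/-- The representative `x_i(-1) y_i(1) x_i(-1)` of the simple reflection `s_i` in `G`. -/
def sBar (i : Fin 6) : G := x i (-1) * y i 1 * x i (-1)

/-- The representative in `G` of the Weyl group element `w`: the product of the `sBar i` along a
reduced expression of `w` (it does not depend on the reduced expression). -/
def bar (w : Matrix (Fin 6) (Fin 6) ℤ) : G :=
  Classical.epsilon fun g => ∃ l, IsReducedExpr l w ∧ g = (l.map sBar).prod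

/-! ### Fundamental representations and generalized minors -/

/-- The simple Lie algebra of type `E₆`. -/
abbrev 𝔤 : Type := LieAlgebra.e₆ ℂ

/-- The Chevalley generator of `𝔤` that is named by a generator of the Serre presentation. -/
def chevalley (t : CartanMatrix.Generators (Fin 6)) : 𝔤 :=
  LieSubmodule.Quotient.mk (N := CartanMatrix.Relations.toIdeal ℂ CartanMatrix.E₆)
    (FreeLieAlgebra.of ℂ t)

/-- The Chevalley generator `e_i`. -/
def e (i : Fin 6) : 𝔤 := chevalley (.E i)

/-- The Chevalley generator `f_i`. -/
def f (i : Fin 6) : 𝔤 := chevalley (.F i)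

/-- The Chevalley generator `h_i = [e_i, f_i]`. -/
def h (i : Fin 6) : 𝔤 := chevalley (.H i)

section Representations

variable {V : Type*} [AddCommGroup V] [Module ℂ V] [LieRingModule 𝔤 V] [LieModule ℂ 𝔤 V]

/-- `u` lies in the weight space of the weight `μ`, where `μ j` is the eigenvalue of `h_j`. -/
def HasWeight (u : V) (μ : Fin 6 → ℂ) : Prop := ∀ j, ⁅h j, u⁆ = μ j • u

/-- The fundamental weight `ω_i`. -/
def fundWeight (i : Fin 6) : Fin 6 → ℂ := fun j => if j = i then 1 else 0

/-- `V` is the fundamental representation `V(ω_i)` of `𝔤` and of `G`, with highest weight vector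
`v`: a finite-dimensional irreducible representation of `𝔤` with highest weight `ω_i`, integrated
to the representation `ρ` of the simply connected group `G`. -/
structure IsFundamentalRep (i : Fin 6) (ρ : Representation ℂ G V) (v : V) : Prop where
  finite : FiniteDimensional ℂ V
  irreducible : LieModule.IsIrreducible ℂ 𝔤 V
  rho_x : ∀ (j : Fin 6) (a : ℂ), ρ (x j a) = expo (a • LieModule.toEnd ℂ 𝔤 V (e j))
  rho_y : ∀ (j : Fin 6) (a : ℂ), ρ (y j a) = expo (a • LieModule.toEnd ℂ 𝔤 V (f j))
  ne_zero : v ≠ 0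
  e_smul : ∀ j : Fin 6, ⁅e j, v⁆ = 0
  weight : HasWeight v (fundWeight i)

/-- The number `⟨u, v⟩ = c` such that the projection of `u` to the highest weight space `ℂ v` of
`V(ω_i)`, along all other weight spaces, is `c v`. -/
def hwCoeff (i : Fin 6) (v u : V) : ℂ :=
  Classical.epsilon fun c =>
    u - c • v ∈ Submodule.span ℂ {z : V | ∃ μ, μ ≠ fundWeight i ∧ HasWeight z μ}

/-- The generalized minor `Δ_{w₁(ω_i), w₂(ω_i)}(g)`, computed in a representation `V = V(ω_i)` with
highest weight vector `v`. -/
def minor (i : Fin 6) (ρ : Representation ℂ G V) (v : V) (w₁ w₂ : Matrix (Fin 6) (Fin 6) ℤ)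
    (g : G) : ℂ :=
  hwCoeff i v (ρ ((bar w₁)⁻¹ * g * bar w₂) v)

end Representations

/-! ### The reduced expression and the torus -/

/-- The reduced expression `s_{r_36} ⋯ s_{r_1}` of the longest Weyl group element `w₀`; its last 16
letters form a reduced expression of `(w^P)⁻¹`. -/
def w0Word : List (Fin 6) :=
  [1, 2, 3, 1, 4, 3, 1, 2, 4, 3, 5, 4, 2, 3, 4, 5, 1, 3, 4, 2,
   6, 5, 4, 2, 3, 4, 5, 6, 1, 3, 4, 5, 2, 4, 3, 1].map node

/-- The longest Weyl group element. -/
def w0 : Matrix (Fin 6) (Fin 6) ℤ := weylProd w0Word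

/-- The index `r_m` for `1 ≤ m ≤ 36`, where the letters of the expression of `w₀` are numbered from
right to left; moreover `r_{36+i} = i`. -/
def r (m : ℕ) : Fin 6 := if m ≤ 36 then w0Word.getD (36 - m) 0 else node (m - 36)

/-- `u_{≥ m} = s_{r_36} ⋯ s_{r_m}`; this is the neutral element if `m > 36`. -/
def uGE (m : ℕ) : Matrix (Fin 6) (Fin 6) ℤ := weylProd (w0Word.take (37 - m))

/-- The element `y_{r_16}(a_16) ⋯ y_{r_1}(a_1)`, where `a_m` is written `a (m - 1)`. -/
def torusElt (a : Fin 16 → ℂ) : G :=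
  (List.ofFn fun k : Fin 16 => y (r (k + 1)) (a k)).reverse.prod

/-- The algebraic torus `U_-^∘`. -/
def torusU : Set G := {u | ∃ a : Fin 16 → ℂ, (∀ k, a k ≠ 0) ∧ u = torusElt a}

/-! ### Plücker coordinates -/

/-- The Plücker coordinate `p_v(g) = v_0^*(g · v)` of a weight basis vector `v` of `V(ω₁)`. -/
def p (v : PWt) (g : G) : ℂ := ((g : (Matrix PWt PWt ℂ)ˣ) : Matrix PWt PWt ℂ) .v0 v

def q8 (g : G) : ℂ := p .v1 g * p .v7a g - p .v0 g * p .v8 g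

/-- The polynomial `q_8'`. -/
def q8a (g : G) : ℂ := p .v2 g * p .v6a g - p .v1 g * p .v7a g + p .v0 g * p .v8 g

def q10 (g : G) : ℂ := p .v2 g * p .v8b g - p .v1 g * p .v9b g + p .v0 g * p .v10a g

def q12 (g : G) : ℂ := p .v1 g * p .v11b g - p .v0 g * p .v12b g

def q15 (g : G) : ℂ :=
  p .v6a g * (p .v1 g * p .v8a g - p .v0 g * p .v9a g)
    - p .v7b g * (p .v1 g * p .v7a g - p .v0 g * p .v8 g)

def q16 (g : G) : ℂ := p .v7a g * p .v9a g - p .v8 g * p .v8a g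

def q20 (g : G) : ℂ := p .v5b g * p .v15 g - p .v4b g * p .v16 g

def q24 (g : G) : ℂ :=
  p .v0 g * (p .v11a g * p .v13 g - p .v12a g * p .v12b g)
    - p .v1 g * (p .v10b g * p .v13 g - p .v11b g * p .v12a g)
    + p .v2 g * (p .v10b g * p .v12b g - p .v11a g * p .v11b g)

/-! ### The initial seed -/

section Seed

variable {V : Fin 6 → Type*} [∀ i, AddCommGroup (V i)] [∀ i, Module ℂ (V i)]
  [∀ i, LieRingModule 𝔤 (V i)] [∀ i, LieModule ℂ 𝔤 (V i)]

/-- The transposed generalized minor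
`Δ^T_{w₁(ω_i), w₂(ω_i)}(g) = Δ_{w₂ w₀(ω_{σ(i)}), w₁ w₀(ω_{σ(i)})}(g^T)`. -/
def minorT (ρ : ∀ i, Representation ℂ G (V i)) (v : ∀ i, V i) (i : Fin 6)
    (w₁ w₂ : Matrix (Fin 6) (Fin 6) ℤ) (g : G) : ℂ :=
  minor (dynkinSymm i) (ρ (dynkinSymm i)) (v (dynkinSymm i)) (w₂ * w0) (w₁ * w0) (transpose g)

/-- The cluster variable `φ(m, ω_{r_m}) = Δ^T_{u_{≥ m}(ω_{r_m}), w₀(ω_{r_m})}`. -/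
def phi (ρ : ∀ i, Representation ℂ G (V i)) (v : ∀ i, V i) (m : ℕ) (g : G) : ℂ :=
  minorT ρ v (r m) (uGE m) w0 g

end Seed

/-! ### The quiver -/

/-- `m⁺ = l`: the largest `l < m` with `1 ≤ l ≤ 36` and `r_l = r_m`. -/
def IsPlus (m l : ℕ) : Prop :=
  IsGreatest {k : ℕ | 1 ≤ k ∧ k ≤ 36 ∧ k < m ∧ r k = r m} l

/-- The set `e(w₀)` of `w₀`-exchangeable indices: those that do not belong to the last occurrence of
a simple reflection in the expression `s_{r_36} ⋯ s_{r_1}`. -/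
def exchangeable : Set ℕ := {m | 1 ≤ m ∧ m ≤ 36 ∧ ∃ l, 1 ≤ l ∧ l < m ∧ r l = r m}

/-- The indices of the mutable variables. -/
def mutableIdx : Set ℕ := {m | m ≤ 16} ∩ exchangeable

/-- The index `t_i` of a frozen variable: the smallest `t > 16` with `r_t = i` if `i ≠ 6`, and
`t_6 = 36 + 6`. -/
def t (i : Fin 6) : ℕ :=
  if i = node 6 then 42 else sInf {t : ℕ | 16 < t ∧ t ≤ 36 ∧ r t = i}

/-- The vertices of the quiver: `phi m` carries the variable `φ(m, ω_{r_m})`, and `extra` carries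
the additional frozen variable `Δ^T_{ω_6, ω_6}`. -/
inductive SeedVertex
  | phi (m : ℕ)
  | extra
  deriving DecidableEq

/-- The arrows of the quiver of the initial seed.  For `m > l`, with at least one of the two
mutable, there is an arrow `m → l` if `m⁺ = l`, and an arrow `l → m` if `l > m⁺ > l⁺` and the
Cartan integer of `r_m` and `r_l` is negative.  The vertex `extra` has one arrow, to the vertex `m`
such that `m` is the second smallest index with `r_m = σ(6)`. -/
def Arrow : SeedVertex → SeedVertex → Prop
  | .phi a, .phi b =>
      a ∈ mutableIdx ∪ Set.range t ∧ b ∈ mutableIdx ∪ Set.range t ∧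
      (a ∈ mutableIdx ∨ b ∈ mutableIdx) ∧
      (IsPlus a b ∨
        (a < b ∧ ∃ a' b', IsPlus a a' ∧ IsPlus b b' ∧ b' < a ∧ a' < b' ∧
          CartanMatrix.E₆ (r b) (r a) < 0))
  | .extra, .phi m =>
      1 ≤ m ∧ r m = dynkinSymm (node 6) ∧ ∃ l, IsPlus m l ∧ ∀ k, ¬ IsPlus l k
  | _, .extra => False

/-- The arrows of the drawn quiver. -/
def drawnArrows : List (SeedVertex × SeedVertex) :=
  (([(20, 8), (17, 13), (19, 12), (12, 7), (18, 14), (14, 11), (11, 6), (21, 15), (15, 10),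
    (42, 16), (8, 12), (7, 11), (13, 14), (16, 21), (15, 18), (6, 13), (6, 10), (10, 11),
    (10, 16), (11, 12), (11, 15), (12, 20), (12, 14), (14, 19), (14, 17)] : List (ℕ × ℕ)).map
      fun c => (SeedVertex.phi c.1, SeedVertex.phi c.2)) ++ [(.extra, .phi 8)]

end

end CayleyPlane

open CayleyPlane

namespace CayleyPlane

noncomputable section

/-! ### Exponentials of nilpotent elements -/

section Expo

variable {A B : Type*} [Ring A] [Algebra ℂ A] [Ring B] [Algebra ℂ B]

/-! A generalized minor is a highest weight coefficient, and such a coefficient does not depend on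
the model. If `v` and `m` are highest weight vectors of the same weight in two representations, the
submodule of the direct sum that `(v, m)` generates under the lowering operators has only the line
of `(v, m)` in that weight. So each word in the one-parameter subgroups has the same coefficient at
`v` as at `m` (`exists_act_sub_mem_otherWts`, `IsFundamentalRep.hwCoeff_eq`). The argument needs
neither the Serre relations nor irreducibility of the second model, which is why `ChevalleyRep`
records neither.

All fundamental weights of E₆ are therefore reached from the 27-dimensional representation and its
twist by the diagram symmetry: these two give ω₁ and ω₆, antisymmetric tensors give ω₃, ω₅ (two
factors) and ω₄ (three factors), and the product of the two gives ω₂. A minor becomes a small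
determinant, or an alternating sum of products, of matrix entries of 27 × 27 matrices.

The representatives of Weyl group elements permute the 27 weight vectors up to sign. Along a reduced
word the sign is a product over an inversion set (`signWord_eq_weylSign`), so it depends only on the
Weyl group element; as `G` is a group of 27 × 27 matrices, `bar w` can be computed from any reduced
word (`bar_eq`).

On the torus each factor acts as `1 + a e_i` after transposition, so matrix entries are sums over
paths in the weight diagram (`entry_subst`). The formulas for the variables thus become identities
between explicit integral polynomials in 16 parameters, verified by collecting terms. The quiver is
a finite check once `m⁺` is computable (`plus`). -/

theorem expo_eq_sum {T : A} {n : ℕ} (hT : T ^ n = 0) :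
    expo T = ∑ k ∈ Finset.range n, ((k.factorial : ℂ)⁻¹) • T ^ k := by
  refine finsum_eq_sum_of_support_subset _ fun k hk => ?_
  by_contra hlt
  refine hk ?_
  have : n ≤ k := by simpa using hlt
  simp [pow_eq_zero_of_le this hT]

theorem expo_map {T : A} (hT : IsNilpotent T) (φ : A →ₐ[ℂ] B) : expo (φ T) = φ (expo T) := by
  obtain ⟨n, hn⟩ := hT
  have hn' : φ T ^ n = 0 := by rw [← map_pow, hn, map_zero]
  simp [expo_eq_sum hn, expo_eq_sum hn', map_sum]

theorem expo_prod {T : A} {S : B} (hT : IsNilpotent T) (hS : IsNilpotent S) :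
    expo ((T, S) : A × B) = (expo T, expo S) := by
  obtain ⟨n, hn⟩ := hT
  obtain ⟨k, hk⟩ := hS
  have h1 : T ^ max n k = 0 := pow_eq_zero_of_le (le_max_left _ _) hn
  have h2 : S ^ max n k = 0 := pow_eq_zero_of_le (le_max_right _ _) hk
  have h3 : ((T, S) : A × B) ^ max n k = 0 := by rw [Prod.pow_mk, h1, h2]; rfl
  rw [expo_eq_sum h1, expo_eq_sum h2, expo_eq_sum h3]
  ext <;> simp [Prod.fst_sum, Prod.snd_sum]

theorem expo_add {T S : A} (h : Commute T S) (hT : IsNilpotent T) (hS : IsNilpotent S) :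
    expo (T + S) = expo T * expo S := by
  -- Restricting scalars to ℚ identifies `expo` with `IsNilpotent.exp`, whose addition formula then
  -- applies.
  let _ : Module ℚ A := Module.compHom A (algebraMap ℚ ℂ)
  have key : ∀ X : A, IsNilpotent X → expo X = IsNilpotent.exp X := by
    rintro X ⟨n, hn⟩
    rw [expo_eq_sum hn, IsNilpotent.exp_eq_sum hn]
    refine Finset.sum_congr rfl fun k _ => ?_
    change _ = (algebraMap ℚ ℂ ((k.factorial : ℚ)⁻¹)) • X ^ k
    simp
  rw [key _ (h.isNilpotent_add hT hS), key _ hT, key _ hS,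
    IsNilpotent.exp_add_of_commute h hT hS]

theorem expo_apply_mem {M : Type*} [AddCommGroup M] [Module ℂ M] {T : Module.End ℂ M}
    (hT : IsNilpotent T) {N : Submodule ℂ M} (hN : ∀ z ∈ N, T z ∈ N) {z : M} (hz : z ∈ N) :
    expo T z ∈ N := by
  obtain ⟨n, hn⟩ := hT
  rw [expo_eq_sum hn, LinearMap.sum_apply]
  refine N.sum_mem fun k hk => N.smul_mem _ ?_
  clear hk
  induction k with
  | zero => simpa using hz
  | succ k ih => rw [pow_succ']; exact hN _ ih

end Expo

/-- By the Leibniz rule, `T ^ k` satisfies the eigenvector equation of ad `H` for `k c`. If no power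
vanished, ad `H` would have infinitely many eigenvalues on a finite-dimensional space. This makes
the `e_i` and `f_i` nilpotent, so that `expo` really is their exponential. -/
theorem isNilpotent_of_commutator {M : Type*} [AddCommGroup M] [Module ℂ M]
    [FiniteDimensional ℂ M] {H T : Module.End ℂ M} {c : ℂ} (hc : c ≠ 0)
    (h : H * T - T * H = c • T) : IsNilpotent T := by
  have hk : ∀ k : ℕ, H * T ^ k - T ^ k * H = ((k : ℂ) * c) • T ^ k := by
    intro k
    induction k with
    | zero => simp
    | succ k ih =>
      have : H * T ^ (k + 1) - T ^ (k + 1) * H =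
          (H * T ^ k - T ^ k * H) * T + T ^ k * (H * T - T * H) := by
        rw [pow_succ]; noncomm_ring
      rw [this, ih, h, pow_succ]
      simp only [smul_mul_assoc, mul_smul_comm, ← add_smul]
      push_cast
      ring_nf
  by_contra hT
  let Φ : Module.End ℂ (Module.End ℂ M) := LinearMap.mulLeft ℂ H - LinearMap.mulRight ℂ H
  have hev : ∀ k : ℕ, Φ.HasEigenvalue ((k : ℂ) * c) := fun k =>
    Module.End.hasEigenvalue_of_hasEigenvector (x := T ^ k)
      ⟨Module.End.mem_eigenspace_iff.mpr (hk k), fun h0 => hT ⟨k, h0⟩⟩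
  refine (Module.End.finite_hasEigenvalue Φ).not_infinite
    (Set.infinite_of_injective_forall_mem (f := fun k : ℕ => (k : ℂ) * c) ?_ hev)
  intro a b hab
  simpa [hc] using hab

/-! ### Representations given by Chevalley operators -/

/-- Operators on `M` satisfying the relations between the Chevalley generators of type `E₆`
other than the Serre relations. -/
structure ChevalleyRep (M : Type*) [AddCommGroup M] [Module ℂ M] where
  E : Fin 6 → Module.End ℂ M
  F : Fin 6 → Module.End ℂ M
  H : Fin 6 → Module.End ℂ M
  comm_E_F : ∀ i j, E i * F j - F j * E i = if i = j then H i else 0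
  comm_H_H : ∀ i j, Commute (H i) (H j)
  comm_H_E : ∀ i j, H i * E j - E j * H i = (CartanMatrix.E₆ i j : ℂ) • E j
  comm_H_F : ∀ i j, H i * F j - F j * H i = -(CartanMatrix.E₆ i j : ℂ) • F j
  nilp_E : ∀ i, IsNilpotent (E i)
  nilp_F : ∀ i, IsNilpotent (F i)

/-- A word in the one-parameter subgroups: `(true, i, a)` stands for `x_i(a)` and `(false, i, a)`
stands for `y_i(a)`. -/
abbrev Word : Type := List (Bool × Fin 6 × ℂ)

/-- The element of `G` given by a word. -/
def wordG (w : Word) : G := (w.map fun s => cond s.1 (x s.2.1 s.2.2) (y s.2.1 s.2.2)).prod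

theorem wordG_append (w w' : Word) : wordG (w ++ w') = wordG w * wordG w' := by
  simp [wordG]

namespace ChevalleyRep

variable {M M' : Type*} [AddCommGroup M] [Module ℂ M] [AddCommGroup M'] [Module ℂ M']

/-- The operator given by a word. -/
def act (R : ChevalleyRep M) (w : Word) : Module.End ℂ M :=
  (w.map fun s => expo (s.2.2 • cond s.1 (R.E s.2.1) (R.F s.2.1))).prod

@[simp] theorem act_nil (R : ChevalleyRep M) : R.act [] = 1 := rfl

theorem act_cons (R : ChevalleyRep M) (s : Bool × Fin 6 × ℂ) (w : Word) :
    R.act (s :: w) = expo (s.2.2 • cond s.1 (R.E s.2.1) (R.F s.2.1)) * R.act w := by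
  simp [act]

theorem act_append (R : ChevalleyRep M) (w w' : Word) : R.act (w ++ w') = R.act w * R.act w' := by
  simp [act]

theorem nilp_letter (R : ChevalleyRep M) (s : Bool × Fin 6 × ℂ) :
    IsNilpotent (s.2.2 • cond s.1 (R.E s.2.1) (R.F s.2.1)) := by
  rcases s with ⟨_ | _, i, a⟩
  · exact (R.nilp_F i).smul a
  · exact (R.nilp_E i).smul a

/-- `z` has weight `μ`. -/
def HasWt (R : ChevalleyRep M) (z : M) (μ : Fin 6 → ℂ) : Prop := ∀ j, R.H j z = μ j • z

/-- The span of the weight spaces of the weights other than `μ`. -/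
def otherWts (R : ChevalleyRep M) (μ : Fin 6 → ℂ) : Submodule ℂ M :=
  Submodule.span ℂ {z | ∃ ν, ν ≠ μ ∧ R.HasWt z ν}

/-- `m` is a (possibly zero) highest weight vector of weight `μ`. -/
structure IsHighest (R : ChevalleyRep M) (μ : Fin 6 → ℂ) (m : M) : Prop where
  E_apply : ∀ j, R.E j m = 0
  weight : R.HasWt m μ

theorem E_F_apply (R : ChevalleyRep M) (i j : Fin 6) (z : M) :
    R.E i (R.F j z) = R.F j (R.E i z) + if i = j then R.H i z else 0 := by
  have := congrArg (fun T : Module.End ℂ M => T z) (R.comm_E_F i j)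
  simp only [LinearMap.sub_apply, Module.End.mul_apply] at this
  rw [← sub_eq_iff_eq_add', this]
  split_ifs <;> rfl

theorem H_F_apply (R : ChevalleyRep M) (i j : Fin 6) (z : M) :
    R.H i (R.F j z) = R.F j (R.H i z) - (CartanMatrix.E₆ i j : ℂ) • R.F j z := by
  have := congrArg (fun T : Module.End ℂ M => T z) (R.comm_H_F i j)
  simp only [LinearMap.sub_apply, Module.End.mul_apply, neg_smul, LinearMap.neg_apply,
    LinearMap.smul_apply] at this
  rw [sub_eq_add_neg, ← this]; abel

/-- The vector `f_{i_1} ⋯ f_{i_d} m`. -/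
def lower (R : ChevalleyRep M) (m : M) : List (Fin 6) → M
  | [] => m
  | i :: l => R.F i (R.lower m l)

/-- The weight of `f_{i_1} ⋯ f_{i_d} m` for `m` of weight `μ`. -/
def lowerWt (μ : Fin 6 → ℂ) : List (Fin 6) → Fin 6 → ℂ
  | [] => μ
  | i :: l => fun j => lowerWt μ l j - CartanMatrix.E₆ j i

theorem hasWt_lower (R : ChevalleyRep M) {μ : Fin 6 → ℂ} {m : M} (hm : R.HasWt m μ)
    (l : List (Fin 6)) : R.HasWt (R.lower m l) (lowerWt μ l) := by
  induction l with
  | nil => exact hm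
  | cons i l ih =>
    intro j
    simp only [lower, lowerWt]
    rw [H_F_apply, ih j, map_smul, sub_smul]

/-- The pairing with the sum of the positive coroots. -/
def coheight (μ : Fin 6 → ℂ) : ℂ :=
  16 * μ 0 + 22 * μ 1 + 30 * μ 2 + 42 * μ 3 + 30 * μ 4 + 16 * μ 5

/-- Every simple root pairs to 2 with the sum of the positive coroots, so each lowering operator
costs exactly 2. Hence a nonempty string of lowering operators never returns to the initial weight.
-/
theorem coheight_lowerWt (μ : Fin 6 → ℂ) (l : List (Fin 6)) :
    coheight (lowerWt μ l) = coheight μ - 2 * l.length := by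
  induction l with
  | nil => simp [lowerWt]
  | cons i l ih =>
    have : coheight (lowerWt μ (i :: l)) = coheight (lowerWt μ l) - 2 := by
      simp only [coheight, lowerWt]
      fin_cases i <;> simp [CartanMatrix.E₆] <;> ring
    rw [this, ih]
    push_cast [List.length_cons]
    ring

theorem lowerWt_ne (μ : Fin 6 → ℂ) {l : List (Fin 6)} (hl : l ≠ []) : lowerWt μ l ≠ μ := by
  intro h
  have := coheight_lowerWt μ l
  rw [h] at this
  have h0 : (l.length : ℂ) = 0 := by linear_combination (1 / 2) * this
  exact hl (List.length_eq_zero_iff.mp (by exact_mod_cast h0))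

/-! ### Highest weight coefficients and their independence of the model -/

/-- The submodule generated by `m` under the lowering operators. -/
def cyclic (R : ChevalleyRep M) (m : M) : Submodule ℂ M :=
  Submodule.span ℂ (Set.range (R.lower m))

theorem lower_mem_cyclic (R : ChevalleyRep M) (m : M) (l : List (Fin 6)) :
    R.lower m l ∈ R.cyclic m := Submodule.subset_span ⟨l, rfl⟩

theorem F_mem_cyclic (R : ChevalleyRep M) (m : M) (i : Fin 6) :
    ∀ z ∈ R.cyclic m, R.F i z ∈ R.cyclic m := by
  intro z hz
  refine Submodule.span_induction (p := fun z _ => R.F i z ∈ R.cyclic m) ?_ (by simp)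
    (fun a b _ _ ha hb => ?_) (fun c a _ ha => ?_) hz
  · rintro _ ⟨l, rfl⟩
    exact R.lower_mem_cyclic m (i :: l)
  · rw [map_add]; exact add_mem ha hb
  · rw [map_smul]; exact Submodule.smul_mem _ _ ha

/-- A raising operator is moved to the right through the lowering operators until it kills `m`; the
correction terms `H_i` act by scalars because each string is a weight vector. -/
theorem E_mem_cyclic (R : ChevalleyRep M) {μ : Fin 6 → ℂ} {m : M} (hm : R.IsHighest μ m)
    (i : Fin 6) : ∀ z ∈ R.cyclic m, R.E i z ∈ R.cyclic m := by
  intro z hz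
  refine Submodule.span_induction (p := fun z _ => R.E i z ∈ R.cyclic m) ?_ (by simp)
    (fun a b _ _ ha hb => ?_) (fun c a _ ha => ?_) hz
  · rintro _ ⟨l, rfl⟩
    induction l with
    | nil => simp [lower, hm.E_apply]
    | cons j l ih =>
      simp only [lower]
      rw [E_F_apply]
      refine add_mem (R.F_mem_cyclic m j _ ih) ?_
      split_ifs
      · rw [R.hasWt_lower hm.weight l i]
        exact Submodule.smul_mem _ _ (R.lower_mem_cyclic m l)
      · exact zero_mem _
  · rw [map_add]; exact add_mem ha hb
  · rw [map_smul]; exact Submodule.smul_mem _ _ ha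

theorem act_mem_cyclic (R : ChevalleyRep M) {μ : Fin 6 → ℂ} {m : M} (hm : R.IsHighest μ m)
    (w : Word) : R.act w m ∈ R.cyclic m := by
  induction w with
  | nil => exact R.lower_mem_cyclic m []
  | cons s w ih =>
    rw [act_cons]
    refine expo_apply_mem (R.nilp_letter s) (fun z hz => ?_) ih
    rcases s with ⟨_ | _, i, a⟩
    · exact Submodule.smul_mem _ _ (R.F_mem_cyclic m i z hz)
    · exact Submodule.smul_mem _ _ (R.E_mem_cyclic hm i z hz)

/-- Among the spanning strings only the empty one has weight `μ`. -/
theorem exists_sub_mem_otherWts_of_mem_cyclic (R : ChevalleyRep M) {μ : Fin 6 → ℂ} {m : M}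
    (hm : R.HasWt m μ) {z : M} (hz : z ∈ R.cyclic m) : ∃ c : ℂ, z - c • m ∈ R.otherWts μ := by
  refine Submodule.span_induction (p := fun z _ => ∃ c : ℂ, z - c • m ∈ R.otherWts μ)
    ?_ ⟨0, by simp⟩ (fun a b _ _ ha hb => ?_) (fun c a _ ha => ?_) hz
  · rintro _ ⟨l, rfl⟩
    rcases eq_or_ne l [] with rfl | hl
    · exact ⟨1, by simp [lower]⟩
    · refine ⟨0, ?_⟩
      rw [zero_smul, sub_zero]
      exact Submodule.subset_span ⟨_, lowerWt_ne μ hl, R.hasWt_lower hm l⟩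
  · obtain ⟨c, hc⟩ := ha
    obtain ⟨d, hd⟩ := hb
    refine ⟨c + d, ?_⟩
    convert add_mem hc hd using 1
    module
  · obtain ⟨d, hd⟩ := ha
    refine ⟨c * d, ?_⟩
    convert Submodule.smul_mem _ c hd using 1
    module

/-- A vector of weight `μ` is not a combination of vectors of other weights. -/
theorem eq_zero_of_smul_mem_otherWts (R : ChevalleyRep M) {μ : Fin 6 → ℂ} {m : M}
    (hm : R.HasWt m μ) (hm0 : m ≠ 0) {c : ℂ} (hc : c • m ∈ R.otherWts μ) : c = 0 := by
  have hcomm : ∀ T ∈ Algebra.adjoin ℂ (Set.range R.H), ∀ T' ∈ Algebra.adjoin ℂ (Set.range R.H),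
      T * T' = T' * T := by
    intro T hT T' hT'
    have := Algebra.isMulCommutative_adjoin ℂ (s := Set.range R.H) (by
      rintro _ ⟨i, rfl⟩ _ ⟨j, rfl⟩
      exact R.comm_H_H i j)
    exact congrArg Subtype.val (mul_comm' (⟨T, hT⟩ : Algebra.adjoin ℂ (Set.range R.H)) ⟨T', hT'⟩)
  -- The operator `T` is a product of factors `H_j - ν_j`, one for each weight vector in an
  -- expression of `c • m`. It kills that expression, but multiplies `m` by a product of nonzero
  -- differences `μ_j - ν_j`.
  have key : ∃ T ∈ Algebra.adjoin ℂ (Set.range R.H),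
      T (c • m) = 0 ∧ ∃ d : ℂ, d ≠ 0 ∧ T m = d • m := by
    refine Submodule.span_induction (p := fun z _ => ∃ T ∈ Algebra.adjoin ℂ (Set.range R.H),
      T z = 0 ∧ ∃ d : ℂ, d ≠ 0 ∧ T m = d • m) ?_ ?_ ?_ ?_ hc
    · rintro z ⟨ν, hν, hz⟩
      obtain ⟨j, hj⟩ := Function.ne_iff.mp hν
      refine ⟨R.H j - algebraMap ℂ _ (ν j), sub_mem (Algebra.subset_adjoin ⟨j, rfl⟩)
        (Subalgebra.algebraMap_mem _ _), ?_, μ j - ν j, sub_ne_zero.mpr hj.symm, ?_⟩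
      · simp [hz j]
      · simp [hm j, sub_smul]
    · exact ⟨1, one_mem _, by simp, 1, one_ne_zero, by simp⟩
    · rintro a b _ _ ⟨T, hT, hTa, d, hd, hTm⟩ ⟨T', hT', hTb, d', hd', hTm'⟩
      refine ⟨T * T', mul_mem hT hT', ?_, d * d', mul_ne_zero hd hd', ?_⟩
      · have h1 : (T * T') a = 0 := by
          rw [hcomm T hT T' hT', Module.End.mul_apply, hTa, map_zero]
        rw [map_add, h1, Module.End.mul_apply, hTb, map_zero, add_zero]
      · rw [Module.End.mul_apply, hTm', map_smul, hTm, smul_smul, mul_comm]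
    · rintro s a _ ⟨T, hT, hTa, h⟩
      exact ⟨T, hT, by rw [map_smul, hTa, smul_zero], h⟩
  obtain ⟨T, -, hT, d, hd, hTm⟩ := key
  rw [map_smul, hTm, smul_smul] at hT
  simpa [hd, hm0] using hT

/-- The direct sum of two representations. -/
def prod (R : ChevalleyRep M) (S : ChevalleyRep M') : ChevalleyRep (M × M') where
  E i := LinearMap.prodMapAlgHom ℂ M M' (R.E i, S.E i)
  F i := LinearMap.prodMapAlgHom ℂ M M' (R.F i, S.F i)
  H i := LinearMap.prodMapAlgHom ℂ M M' (R.H i, S.H i)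
  comm_E_F i j := by
    rw [← map_mul, ← map_mul, ← map_sub, Prod.mk_mul_mk, Prod.mk_mul_mk, Prod.mk_sub_mk,
      R.comm_E_F, S.comm_E_F]
    split_ifs
    · rfl
    · exact map_zero _
  comm_H_H i j := by
    have : Commute (R.H i, S.H i) (R.H j, S.H j) :=
      Prod.ext (R.comm_H_H i j) (S.comm_H_H i j)
    exact this.map _
  comm_H_E i j := by
    rw [← map_mul, ← map_mul, ← map_sub, Prod.mk_mul_mk, Prod.mk_mul_mk, Prod.mk_sub_mk,
      R.comm_H_E, S.comm_H_E, ← Prod.smul_mk, map_smul]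
  comm_H_F i j := by
    rw [← map_mul, ← map_mul, ← map_sub, Prod.mk_mul_mk, Prod.mk_mul_mk, Prod.mk_sub_mk,
      R.comm_H_F, S.comm_H_F, ← Prod.smul_mk, map_smul]
  nilp_E i := by
    obtain ⟨n, hn⟩ := R.nilp_E i
    obtain ⟨k, hk⟩ := S.nilp_E i
    refine ⟨max n k, ?_⟩
    rw [← map_pow, Prod.pow_mk, pow_eq_zero_of_le (le_max_left _ _) hn,
      pow_eq_zero_of_le (le_max_right _ _) hk]
    exact map_zero _
  nilp_F i := by
    obtain ⟨n, hn⟩ := R.nilp_F i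
    obtain ⟨k, hk⟩ := S.nilp_F i
    refine ⟨max n k, ?_⟩
    rw [← map_pow, Prod.pow_mk, pow_eq_zero_of_le (le_max_left _ _) hn,
      pow_eq_zero_of_le (le_max_right _ _) hk]
    exact map_zero _

theorem act_prod (R : ChevalleyRep M) (S : ChevalleyRep M') (w : Word) (z : M × M') :
    (R.prod S).act w z = (R.act w z.1, S.act w z.2) := by
  induction w with
  | nil => simp
  | cons s w ih =>
    have h : s.2.2 • cond s.1 ((R.prod S).E s.2.1) ((R.prod S).F s.2.1) =
        LinearMap.prodMapAlgHom ℂ M M' (s.2.2 • cond s.1 (R.E s.2.1) (R.F s.2.1),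
          s.2.2 • cond s.1 (S.E s.2.1) (S.F s.2.1)) := by
      rcases s with ⟨_ | _, i, a⟩ <;> rfl
    have hn : IsNilpotent ((s.2.2 • cond s.1 (R.E s.2.1) (R.F s.2.1),
          s.2.2 • cond s.1 (S.E s.2.1) (S.F s.2.1)) : Module.End ℂ M × Module.End ℂ M') := by
      obtain ⟨n, hn⟩ := R.nilp_letter s
      obtain ⟨k, hk⟩ := S.nilp_letter s
      refine ⟨max n k, ?_⟩
      rw [Prod.pow_mk, pow_eq_zero_of_le (le_max_left _ _) hn,
        pow_eq_zero_of_le (le_max_right _ _) hk]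
      rfl
    rw [act_cons, act_cons, act_cons, Module.End.mul_apply, ih, h, expo_map hn,
      expo_prod (R.nilp_letter s) (S.nilp_letter s)]
    rfl

/-- The highest weight coefficients of `w · v` and `w · m` agree for highest weight vectors `v` and
`m` of the same weight in any two representations. -/
theorem exists_act_sub_mem_otherWts (R : ChevalleyRep M) (S : ChevalleyRep M') {μ : Fin 6 → ℂ}
    {v : M} {m : M'} (hv : R.IsHighest μ v) (hm : S.IsHighest μ m) (w : Word) :
    ∃ c : ℂ, R.act w v - c • v ∈ R.otherWts μ ∧ S.act w m - c • m ∈ S.otherWts μ := by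
  -- Working with the pair forces one scalar `c` to serve both components; the two projections then
  -- give the two claims.
  have hvm : (R.prod S).IsHighest μ (v, m) :=
    ⟨fun j => Prod.ext (hv.E_apply j) (hm.E_apply j),
      fun j => Prod.ext (hv.weight j) (hm.weight j)⟩
  obtain ⟨c, hc⟩ := (R.prod S).exists_sub_mem_otherWts_of_mem_cyclic hvm.weight
    ((R.prod S).act_mem_cyclic hvm w)
  rw [act_prod] at hc
  refine ⟨c, ?_, ?_⟩
  · have h : (R.prod S).otherWts μ ≤ (R.otherWts μ).comap (LinearMap.fst ℂ M M') := by
      refine Submodule.span_le.mpr ?_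
      rintro z ⟨ν, hν, hz⟩
      exact Submodule.subset_span ⟨ν, hν, fun j => congrArg Prod.fst (hz j)⟩
    exact h hc
  · have h : (R.prod S).otherWts μ ≤ (S.otherWts μ).comap (LinearMap.snd ℂ M M') := by
      refine Submodule.span_le.mpr ?_
      rintro z ⟨ν, hν, hz⟩
      exact Submodule.subset_span ⟨ν, hν, fun j => congrArg Prod.snd (hz j)⟩
    exact h hc

/-- `ξ` is a functional of weight `μ`: it vanishes on the weight spaces of all other weights. -/
def IsWtFunctional (R : ChevalleyRep M) (μ : Fin 6 → ℂ) (ξ : M →ₗ[ℂ] ℂ) : Prop :=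
  ∀ j z, ξ (R.H j z) = μ j * ξ z

theorem IsWtFunctional.eq_zero {R : ChevalleyRep M} {μ : Fin 6 → ℂ} {ξ : M →ₗ[ℂ] ℂ}
    (hξ : R.IsWtFunctional μ ξ) {z : M} (hz : z ∈ R.otherWts μ) : ξ z = 0 := by
  have : R.otherWts μ ≤ LinearMap.ker ξ := by
    refine Submodule.span_le.mpr ?_
    rintro z ⟨ν, hν, hz⟩
    obtain ⟨j, hj⟩ := Function.ne_iff.mp hν
    have h := hξ j z
    rw [hz j, map_smul, smul_eq_mul] at h
    exact (mul_eq_mul_right_iff.mp h).resolve_left hj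
  exact this hz

end ChevalleyRep

/-! ### Fundamental representations -/

section Fundamental

/-- The `.inl`/`.inr` chains in its applications select the families HH, EF, HE and HF from the
union that defines the Serre presentation. -/
theorem chevalley_rel {z : FreeLieAlgebra ℂ (CartanMatrix.Generators (Fin 6))}
    (hz : z ∈ CartanMatrix.Relations.toSet ℂ CartanMatrix.E₆) :
    LieSubmodule.Quotient.mk (N := CartanMatrix.Relations.toIdeal ℂ CartanMatrix.E₆) z = 0 :=
  LieSubmodule.Quotient.mk_eq_zero'.mpr (LieSubmodule.subset_lieSpan hz)

theorem lie_h_h (i j : Fin 6) : ⁅h i, h j⁆ = 0 :=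
  chevalley_rel (.inl <| .inl <| .inl <| .inl <| .inl ⟨(i, j), rfl⟩)

theorem lie_e_f (i j : Fin 6) : ⁅e i, f j⁆ = if i = j then h i else 0 := by
  have := chevalley_rel (.inl <| .inl <| .inl <| .inl <| .inr ⟨(i, j), rfl⟩)
  by_cases hij : i = j
  · subst hij
    simp only [CartanMatrix.Relations.EF, Function.uncurry, if_true] at this ⊢
    exact sub_eq_zero.mp this
  · simp only [CartanMatrix.Relations.EF, Function.uncurry, if_neg hij] at this ⊢
    exact this

theorem lie_h_e (i j : Fin 6) : ⁅h i, e j⁆ = CartanMatrix.E₆ i j • e j :=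
  sub_eq_zero.mp (chevalley_rel (.inl <| .inl <| .inl <| .inr ⟨(i, j), rfl⟩))

theorem lie_h_f (i j : Fin 6) : ⁅h i, f j⁆ = -(CartanMatrix.E₆ i j • f j) :=
  eq_neg_of_add_eq_zero_left (chevalley_rel (.inl <| .inl <| .inr ⟨(i, j), rfl⟩))

variable {V : Type*} [AddCommGroup V] [Module ℂ V] [LieRingModule 𝔤 V] [LieModule ℂ 𝔤 V]

theorem toEnd_commutator (a b : 𝔤) :
    LieModule.toEnd ℂ 𝔤 V a * LieModule.toEnd ℂ 𝔤 V b -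
      LieModule.toEnd ℂ 𝔤 V b * LieModule.toEnd ℂ 𝔤 V a = LieModule.toEnd ℂ 𝔤 V ⁅a, b⁆ := by
  ext z
  exact (lie_lie a b z).symm

theorem cartanMatrix_diag (i : Fin 6) : CartanMatrix.E₆ i i = 2 := by
  fin_cases i <;> rfl

variable (V) in
/-- The Chevalley operators of a finite-dimensional representation of `𝔤`. -/
def ChevalleyRep.ofLie [FiniteDimensional ℂ V] : ChevalleyRep V where
  E i := LieModule.toEnd ℂ 𝔤 V (e i)
  F i := LieModule.toEnd ℂ 𝔤 V (f i)
  H i := LieModule.toEnd ℂ 𝔤 V (h i)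
  comm_E_F i j := by
    rw [toEnd_commutator, lie_e_f]
    split_ifs <;> simp
  comm_H_H i j := by
    rw [Commute, SemiconjBy, ← sub_eq_zero, toEnd_commutator, lie_h_h, map_zero]
  comm_H_E i j := by rw [toEnd_commutator, lie_h_e, map_zsmul, Int.cast_smul_eq_zsmul]
  comm_H_F i j := by
    rw [toEnd_commutator, lie_h_f, map_neg, map_zsmul, neg_smul, Int.cast_smul_eq_zsmul]
  nilp_E i := by
    refine isNilpotent_of_commutator (H := LieModule.toEnd ℂ 𝔤 V (h i)) (two_ne_zero (α := ℂ)) ?_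
    rw [toEnd_commutator, lie_h_e, cartanMatrix_diag, map_zsmul, ← Int.cast_smul_eq_zsmul ℂ]
    norm_num
  nilp_F i := by
    refine isNilpotent_of_commutator (H := LieModule.toEnd ℂ 𝔤 V (h i))
      (neg_ne_zero.mpr (two_ne_zero (α := ℂ))) ?_
    rw [toEnd_commutator, lie_h_f, cartanMatrix_diag, map_neg, map_zsmul,
      ← Int.cast_smul_eq_zsmul ℂ]
    norm_num

/-- The highest weight coefficient in a fundamental representation can be computed in any
representation with a highest weight vector of the same weight. -/
theorem IsFundamentalRep.hwCoeff_eq {i : Fin 6} {ρ : Representation ℂ G V} {v : V}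
    (hV : IsFundamentalRep i ρ v) {M : Type*} [AddCommGroup M] [Module ℂ M] (S : ChevalleyRep M)
    {m : M} (hm : S.IsHighest (fundWeight i) m) {ξ : M →ₗ[ℂ] ℂ}
    (hξ : S.IsWtFunctional (fundWeight i) ξ) (hξm : ξ m = 1) (w : Word) :
    hwCoeff i v (ρ (wordG w) v) = ξ (S.act w m) := by
  have := hV.finite
  set R := ChevalleyRep.ofLie V with hR
  have hv : R.IsHighest (fundWeight i) v := ⟨hV.e_smul, hV.weight⟩
  have hact : ρ (wordG w) = R.act w := by
    induction w with
    | nil => exact map_one ρ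
    | cons s w ih =>
      have : wordG (s :: w) = cond s.1 (x s.2.1 s.2.2) (y s.2.1 s.2.2) * wordG w := by
        simp [wordG]
      rw [this, map_mul, ih, ChevalleyRep.act_cons]
      rcases s with ⟨_ | _, j, a⟩
      · exact congrArg (· * _) (hV.rho_y j a)
      · exact congrArg (· * _) (hV.rho_x j a)
  obtain ⟨c, hc, hc'⟩ := R.exists_act_sub_mem_otherWts S hv hm w
  have hcoeff : ξ (S.act w m) = c := by
    have := hξ.eq_zero hc'
    rw [map_sub, map_smul, hξm, smul_eq_mul, mul_one, sub_eq_zero] at this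
    exact this
  rw [hcoeff, hact]
  -- The `epsilon` in `hwCoeff` has its defining property because `c` is a witness. The witness is
  -- unique by `eq_zero_of_smul_mem_otherWts`.
  have hspec : R.act w v - hwCoeff i v (R.act w v) • v ∈ R.otherWts (fundWeight i) :=
    Classical.epsilon_spec (p := fun c : ℂ => R.act w v - c • v ∈
      Submodule.span ℂ {z : V | ∃ μ, μ ≠ fundWeight i ∧ HasWeight z μ}) ⟨c, hc⟩
  have hdiff : (hwCoeff i v (R.act w v) - c) • v ∈ R.otherWts (fundWeight i) := by
    convert sub_mem hc hspec using 1
    module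
  exact sub_eq_zero.mp (R.eq_zero_of_smul_mem_otherWts hv.weight hV.ne_zero hdiff)

end Fundamental

end

noncomputable section

/-! ### Tensor products and twists -/

namespace ChevalleyRep

open TensorProduct

variable {M M' : Type*} [AddCommGroup M] [Module ℂ M] [AddCommGroup M'] [Module ℂ M']

/-- The operator `T ⊗ 1 + 1 ⊗ T'`. -/
def tensorSum (T : Module.End ℂ M) (T' : Module.End ℂ M') : Module.End ℂ (M ⊗[ℂ] M') :=
  Module.End.rTensorAlgHom ℂ M M' T + Module.End.lTensorAlgHom ℂ M' M T'

theorem commute_rTensor_lTensor (T : Module.End ℂ M) (T' : Module.End ℂ M') :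
    Commute (Module.End.rTensorAlgHom ℂ M M' T) (Module.End.lTensorAlgHom ℂ M' M T') :=
  TensorProduct.ext' fun _ _ => rfl

theorem tensorSum_tmul (T : Module.End ℂ M) (T' : Module.End ℂ M') (a : M) (b : M') :
    tensorSum T T' (a ⊗ₜ b) = T a ⊗ₜ b + a ⊗ₜ T' b := rfl

theorem tensorSum_commutator (A B : Module.End ℂ M) (A' B' : Module.End ℂ M') :
    tensorSum A A' * tensorSum B B' - tensorSum B B' * tensorSum A A' =
      tensorSum (A * B - B * A) (A' * B' - B' * A') := by
  ext a b
  simp [tensorSum_tmul, TensorProduct.sub_tmul, TensorProduct.tmul_sub]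
  abel

theorem tensorSum_smul (c : ℂ) (A : Module.End ℂ M) (A' : Module.End ℂ M') :
    tensorSum (c • A) (c • A') = c • tensorSum A A' := by
  simp [tensorSum]

theorem tensorSum_nilpotent {A : Module.End ℂ M} {A' : Module.End ℂ M'} (hA : IsNilpotent A)
    (hA' : IsNilpotent A') : IsNilpotent (tensorSum A A') :=
  (commute_rTensor_lTensor A A').isNilpotent_add (hA.map _) (hA'.map _)

/-- The two summands commute, so the exponential factors and the group acts diagonally on tensors.
-/
theorem expo_tensorSum {A : Module.End ℂ M} {A' : Module.End ℂ M'} (hA : IsNilpotent A)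
    (hA' : IsNilpotent A') : expo (tensorSum A A') = TensorProduct.map (expo A) (expo A') := by
  rw [tensorSum, expo_add (commute_rTensor_lTensor A A') (hA.map _) (hA'.map _), expo_map hA,
    expo_map hA']
  exact TensorProduct.ext' fun _ _ => rfl

/-- The tensor product of two representations. -/
def tensor (R : ChevalleyRep M) (S : ChevalleyRep M') : ChevalleyRep (M ⊗[ℂ] M') where
  E i := tensorSum (R.E i) (S.E i)
  F i := tensorSum (R.F i) (S.F i)
  H i := tensorSum (R.H i) (S.H i)
  comm_E_F i j := by
    rw [tensorSum_commutator, R.comm_E_F, S.comm_E_F]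
    split_ifs
    · rfl
    · simp [tensorSum]
  comm_H_H i j := by
    rw [Commute, SemiconjBy, ← sub_eq_zero, tensorSum_commutator, (R.comm_H_H i j).eq,
      (S.comm_H_H i j).eq]
    simp [tensorSum]
  comm_H_E i j := by rw [tensorSum_commutator, R.comm_H_E, S.comm_H_E, tensorSum_smul]
  comm_H_F i j := by rw [tensorSum_commutator, R.comm_H_F, S.comm_H_F, tensorSum_smul]
  nilp_E i := tensorSum_nilpotent (R.nilp_E i) (S.nilp_E i)
  nilp_F i := tensorSum_nilpotent (R.nilp_F i) (S.nilp_F i)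

theorem act_tensor (R : ChevalleyRep M) (S : ChevalleyRep M') (w : Word) (a : M) (b : M') :
    (R.tensor S).act w (a ⊗ₜ b) = R.act w a ⊗ₜ S.act w b := by
  induction w with
  | nil => simp
  | cons s w ih =>
    have h : s.2.2 • cond s.1 ((R.tensor S).E s.2.1) ((R.tensor S).F s.2.1) =
        tensorSum (s.2.2 • cond s.1 (R.E s.2.1) (R.F s.2.1))
          (s.2.2 • cond s.1 (S.E s.2.1) (S.F s.2.1)) := by
      rw [tensorSum_smul]
      rcases s with ⟨_ | _, i, a⟩ <;> rfl
    rw [act_cons, act_cons, act_cons, Module.End.mul_apply, ih, h,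
      expo_tensorSum (R.nilp_letter s) (S.nilp_letter s)]
    rfl

theorem tensor_E_tmul (R : ChevalleyRep M) (S : ChevalleyRep M') (i : Fin 6) (a : M) (b : M') :
    (R.tensor S).E i (a ⊗ₜ b) = R.E i a ⊗ₜ b + a ⊗ₜ S.E i b := tensorSum_tmul _ _ _ _

theorem HasWt.tmul {R : ChevalleyRep M} {S : ChevalleyRep M'} {a : M} {b : M'}
    {μ ν : Fin 6 → ℂ} (ha : R.HasWt a μ) (hb : S.HasWt b ν) :
    (R.tensor S).HasWt (a ⊗ₜ b) (μ + ν) := by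
  intro j
  change tensorSum (R.H j) (S.H j) _ = _
  rw [tensorSum_tmul, ha j, hb j, TensorProduct.smul_tmul, TensorProduct.tmul_smul,
    TensorProduct.tmul_smul, ← add_smul]
  rfl

/-- The tensor product of two functionals. -/
def functionalTmul (ξ : M →ₗ[ℂ] ℂ) (η : M' →ₗ[ℂ] ℂ) : M ⊗[ℂ] M' →ₗ[ℂ] ℂ :=
  LinearMap.mul' ℂ ℂ ∘ₗ TensorProduct.map ξ η

@[simp] theorem functionalTmul_tmul (ξ : M →ₗ[ℂ] ℂ) (η : M' →ₗ[ℂ] ℂ) (a : M) (b : M') :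
    functionalTmul ξ η (a ⊗ₜ b) = ξ a * η b := rfl

theorem IsWtFunctional.tmul {R : ChevalleyRep M} {S : ChevalleyRep M'} {μ ν : Fin 6 → ℂ}
    {ξ : M →ₗ[ℂ] ℂ} {η : M' →ₗ[ℂ] ℂ} (hξ : R.IsWtFunctional μ ξ) (hη : S.IsWtFunctional ν η) :
    (R.tensor S).IsWtFunctional (μ + ν) (functionalTmul ξ η) := by
  intro j z
  induction z using TensorProduct.induction_on with
  | zero => simp
  | tmul a b =>
    change functionalTmul ξ η (tensorSum (R.H j) (S.H j) _) = _
    rw [tensorSum_tmul, map_add]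
    simp only [functionalTmul_tmul, hξ j, hη j, Pi.add_apply]
    ring
  | add a b ha hb => rw [map_add, map_add, map_add, ha, hb, mul_add]

theorem dynkinSymm_injective : Function.Injective dynkinSymm := by decide

/-- The Cartan integer `a_{ij}`. -/
def _root_.CayleyPlane.cartan (i j : Fin 6) : ℤ := CartanMatrix.E₆ i j

theorem cartan_dynkinSymm : ∀ i j, cartan (dynkinSymm i) (dynkinSymm j) = cartan i j := by
  decide

theorem cartanMatrix_dynkinSymm (i j : Fin 6) :
    CartanMatrix.E₆ (dynkinSymm i) (dynkinSymm j) = CartanMatrix.E₆ i j :=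
  cartan_dynkinSymm i j

/-- The twist of a representation by the symmetry of the Dynkin diagram. -/
def twist (R : ChevalleyRep M) : ChevalleyRep M where
  E i := R.E (dynkinSymm i)
  F i := R.F (dynkinSymm i)
  H i := R.H (dynkinSymm i)
  comm_E_F i j := by rw [R.comm_E_F]; simp [dynkinSymm_injective.eq_iff]
  comm_H_H i j := R.comm_H_H _ _
  comm_H_E i j := by rw [R.comm_H_E, cartanMatrix_dynkinSymm]
  comm_H_F i j := by rw [R.comm_H_F, cartanMatrix_dynkinSymm]
  nilp_E i := R.nilp_E _
  nilp_F i := R.nilp_F _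

/-- The twist of a word by the symmetry of the Dynkin diagram. -/
def _root_.CayleyPlane.twistWord (w : Word) : Word :=
  w.map fun s => (s.1, dynkinSymm s.2.1, s.2.2)

theorem act_twist (R : ChevalleyRep M) (w : Word) : R.twist.act w = R.act (twistWord w) := by
  simp only [act, twistWord, List.map_map]
  rfl

end ChevalleyRep

/-! ### The minuscule representation -/

/-- The weight `w` with `f_i v = w`, if there is one. -/
def PWt.down (i : Fin 6) (v : PWt) : Option PWt :=
  (hasseEdges.find? fun x => x.1 = v ∧ x.2.1 = (i : ℕ) + 1).map fun x => x.2.2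

/-- The weight `w` with `e_i v = w`, if there is one. -/
def PWt.up (i : Fin 6) (v : PWt) : Option PWt :=
  (hasseEdges.find? fun x => x.2.2 = v ∧ x.2.1 = (i : ℕ) + 1).map fun x => x.1

theorem mem_hasseEdges_iff_down {v w : PWt} {i : Fin 6} :
    (v, (i : ℕ) + 1, w) ∈ hasseEdges ↔ v.down i = some w := by
  constructor
  · have : ∀ x ∈ hasseEdges, ∀ i : Fin 6, x.2.1 = i + 1 → x.1.down i = some x.2.2 := by decide
    exact fun h => this _ h i rfl
  · intro h
    obtain ⟨x, hx, rfl⟩ := Option.map_eq_some_iff.mp h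
    have h1 := List.find?_some hx
    have h2 := List.mem_of_find?_eq_some hx
    simp only [decide_eq_true_eq] at h1
    rwa [← h1.1, ← h1.2]

theorem mem_hasseEdges_iff_up {v w : PWt} {i : Fin 6} :
    (v, (i : ℕ) + 1, w) ∈ hasseEdges ↔ w.up i = some v := by
  constructor
  · have : ∀ x ∈ hasseEdges, ∀ i : Fin 6, x.2.1 = i + 1 → x.2.2.up i = some x.1 := by decide
    exact fun h => this _ h i rfl
  · intro h
    obtain ⟨x, hx, rfl⟩ := Option.map_eq_some_iff.mp h
    have h1 := List.find?_some hx
    have h2 := List.mem_of_find?_eq_some hx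
    simp only [decide_eq_true_eq] at h1
    rwa [← h1.1, ← h1.2]

theorem down_eq_some_iff {v w : PWt} {i : Fin 6} : v.down i = some w ↔ w.up i = some v :=
  mem_hasseEdges_iff_down.symm.trans mem_hasseEdges_iff_up

/-- The coordinate of the weight `v` at `ω_i`. -/
def PWt.wt (v : PWt) (i : Fin 6) : ℤ :=
  (if (v.down i).isSome then 1 else 0) - if (v.up i).isSome then 1 else 0

theorem up_eq_none_of_down {v w : PWt} {i : Fin 6} (h : v.down i = some w) : v.up i = none := by
  by_contra hu
  obtain ⟨u, hu⟩ := Option.ne_none_iff_exists'.mp hu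
  exact hasseEdges_no_chain _ (mem_hasseEdges_iff_up.mpr hu) _ (mem_hasseEdges_iff_down.mpr h)
    rfl rfl

theorem wt_up {v w : PWt} {i j : Fin 6} (h : v.up j = some w) :
    w.wt i = v.wt i + CartanMatrix.E₆ i j := by
  have : ∀ x ∈ hasseEdges, ∀ j : Fin 6, x.2.1 = j + 1 →
      ∀ i, x.1.wt i = x.2.2.wt i + cartan i j := by decide
  exact this _ (mem_hasseEdges_iff_up.mpr h) j rfl i

/-- This is `[e_i, f_j] = 0` for `i ≠ j`, read on the weight diagram. -/
theorem down_up_comm : ∀ {i j : Fin 6}, i ≠ j → ∀ v : PWt,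
    (v.down j).bind (PWt.up i) = (v.up i).bind (PWt.down j) := by
  decide

/-- The basis vector of weight `v` of the minuscule representation. -/
abbrev bvec (v : PWt) : PWt → ℂ := Pi.single v 1

/-- A basis vector or zero. -/
def obvec (o : Option PWt) : PWt → ℂ := o.elim 0 bvec

@[simp] theorem obvec_none : obvec none = 0 := rfl

@[simp] theorem obvec_some (v : PWt) : obvec (some v) = bvec v := rfl

theorem eMat_mulVec_bvec (i : Fin 6) (v : PWt) :
    Matrix.toLin' (eMat i) (bvec v) = obvec (v.up i) := by
  ext w
  simp only [Matrix.toLin'_apply, Matrix.mulVec_single_one, Matrix.col_apply, eMat, Matrix.of_apply,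
    mem_hasseEdges_iff_up]
  rcases h : v.up i with _ | u
  · simp
  · simp [Pi.single_apply, eq_comm]

theorem fMat_mulVec_bvec (i : Fin 6) (v : PWt) :
    Matrix.toLin' (fMat i) (bvec v) = obvec (v.down i) := by
  ext w
  simp only [Matrix.toLin'_apply, Matrix.mulVec_single_one, Matrix.col_apply, fMat, Matrix.of_apply,
    mem_hasseEdges_iff_down]
  rcases h : v.down i with _ | u
  · simp
  · simp [Pi.single_apply, eq_comm]

theorem eMat_obvec (i : Fin 6) (o : Option PWt) :
    Matrix.toLin' (eMat i) (obvec o) = obvec (o.bind (PWt.up i)) := by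
  rcases o with _ | v
  · simp
  · exact eMat_mulVec_bvec i v

theorem fMat_obvec (i : Fin 6) (o : Option PWt) :
    Matrix.toLin' (fMat i) (obvec o) = obvec (o.bind (PWt.down i)) := by
  rcases o with _ | v
  · simp
  · exact fMat_mulVec_bvec i v

/-- The operator `h_i` on the minuscule representation. -/
def hMat (i : Fin 6) : Matrix PWt PWt ℂ := Matrix.diagonal fun v => (v.wt i : ℂ)

theorem hMat_bvec (i : Fin 6) (v : PWt) :
    Matrix.toLin' (hMat i) (bvec v) = (v.wt i : ℂ) • bvec v := by
  ext w
  simp only [Matrix.toLin'_apply, hMat, Matrix.mulVec_diagonal, Pi.smul_apply, smul_eq_mul]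
  by_cases h : w = v
  · simp [h]
  · simp [h]

theorem end_ext {T T' : Module.End ℂ (PWt → ℂ)} (h : ∀ v, T (bvec v) = T' (bvec v)) : T = T' :=
  (Pi.basisFun ℂ PWt).ext fun v => by simpa using h v

/-- The minuscule representation `V(ω₁)`. -/
def minuscule : ChevalleyRep (PWt → ℂ) where
  E i := Matrix.toLin' (eMat i)
  F i := Matrix.toLin' (fMat i)
  H i := Matrix.toLin' (hMat i)
  comm_E_F i j := end_ext fun v => by
    simp only [LinearMap.sub_apply, Module.End.mul_apply, eMat_mulVec_bvec, fMat_mulVec_bvec,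
      eMat_obvec, fMat_obvec]
    split_ifs with hij
    · subst hij
      rw [hMat_bvec, PWt.wt]
      rcases hd : v.down i with _ | w
      · rcases hu : v.up i with _ | w
        · simp
        · simp [down_eq_some_iff.mpr hu]
      · simp [up_eq_none_of_down hd, down_eq_some_iff.mp hd]
    · rw [down_up_comm hij, sub_self, LinearMap.zero_apply]
  comm_H_H i j := end_ext fun v => by
    simp only [Module.End.mul_apply, hMat_bvec, map_smul, smul_smul, mul_comm]
  comm_H_E i j := end_ext fun v => by
    simp only [LinearMap.sub_apply, Module.End.mul_apply, LinearMap.smul_apply, hMat_bvec,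
      eMat_mulVec_bvec, map_smul]
    rcases hu : v.up j with _ | w
    · simp
    · simp only [obvec_some, hMat_bvec, wt_up hu, Int.cast_add]
      module
  comm_H_F i j := end_ext fun v => by
    simp only [LinearMap.sub_apply, Module.End.mul_apply, LinearMap.smul_apply, hMat_bvec,
      fMat_mulVec_bvec, map_smul]
    rcases hu : v.down j with _ | w
    · simp
    · simp only [obvec_some, hMat_bvec, wt_up (down_eq_some_iff.mp hu), Int.cast_add]
      module
  nilp_E i := ⟨2, by rw [pow_two, Module.End.mul_eq_comp, ← Matrix.toLin'_mul, eMat_mul_self, map_zero]⟩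
  nilp_F i := ⟨2, by rw [pow_two, Module.End.mul_eq_comp, ← Matrix.toLin'_mul, fMat_mul_self, map_zero]⟩

end

noncomputable section

open Matrix

/-! ### Roots -/

/-- The positive roots, in coordinates with respect to the simple roots. -/
def posRootList : List (Fin 6 → ℤ) :=
  [![0, 0, 0, 0, 0, 1], ![0, 0, 0, 0, 1, 0], ![0, 0, 0, 1, 0, 0], ![0, 0, 1, 0, 0, 0], ![0, 1, 0, 0, 0, 0], ![1, 0, 0, 0, 0, 0],
   ![0, 0, 0, 0, 1, 1], ![0, 0, 0, 1, 1, 0], ![0, 0, 1, 1, 0, 0], ![0, 1, 0, 1, 0, 0], ![1, 0, 1, 0, 0, 0], ![0, 0, 0, 1, 1, 1],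
   ![0, 0, 1, 1, 1, 0], ![0, 1, 0, 1, 1, 0], ![0, 1, 1, 1, 0, 0], ![1, 0, 1, 1, 0, 0], ![0, 0, 1, 1, 1, 1], ![0, 1, 0, 1, 1, 1],
   ![0, 1, 1, 1, 1, 0], ![1, 0, 1, 1, 1, 0], ![1, 1, 1, 1, 0, 0], ![0, 1, 1, 1, 1, 1], ![0, 1, 1, 2, 1, 0], ![1, 0, 1, 1, 1, 1],
   ![1, 1, 1, 1, 1, 0], ![0, 1, 1, 2, 1, 1], ![1, 1, 1, 1, 1, 1], ![1, 1, 1, 2, 1, 0], ![0, 1, 1, 2, 2, 1], ![1, 1, 1, 2, 1, 1],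
   ![1, 1, 2, 2, 1, 0], ![1, 1, 1, 2, 2, 1], ![1, 1, 2, 2, 1, 1], ![1, 1, 2, 2, 2, 1], ![1, 1, 2, 3, 2, 1], ![1, 2, 2, 3, 2, 1]]

/-- The finite set of the positive roots. -/
def posRoots : Finset (Fin 6 → ℤ) := posRootList.toFinset

/-- The simple root `α_i`. -/
def simpleRoot (i : Fin 6) : Fin 6 → ℤ := fun j => if j = i then 1 else 0

/-- The reflection `s_i` on the root lattice. -/
def reflRoot (i : Fin 6) (γ : Fin 6 → ℤ) : Fin 6 → ℤ := fun j =>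
  γ j - if j = i then γ 0 * cartan 0 i + γ 1 * cartan 1 i + γ 2 * cartan 2 i + γ 3 * cartan 3 i +
    γ 4 * cartan 4 i + γ 5 * cartan 5 i else 0

/-- Column vectors are weights in fundamental coordinates and row vectors are roots in simple root
coordinates. As E₆ is simply laced, the dot product is the pairing of a weight with a coroot. Right
multiplication of rows by `w` is therefore the action of `w⁻¹` on roots. -/
theorem vecMul_simpleReflection (i : Fin 6) (γ : Fin 6 → ℤ) :
    γ ᵥ* simpleReflection i = reflRoot i γ := by
  ext j
  rw [simpleReflection, Matrix.vecMul_sub, Matrix.vecMul_one, Pi.sub_apply, reflRoot]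
  congr 1
  by_cases h : j = i
  · simp [Matrix.vecMul, dotProduct, h, Fin.sum_univ_six, cartan]
  · simp [Matrix.vecMul, dotProduct, h]

theorem simpleReflection_mul_self (i : Fin 6) : simpleReflection i * simpleReflection i = 1 := by
  revert i; decide +kernel

/-- Invariance of the Cartan form, needed to conjugate a root reflection by a simple one. -/
theorem simpleReflection_mul_cartan (i : Fin 6) :
    simpleReflection i * CartanMatrix.E₆ = CartanMatrix.E₆ * (simpleReflection i)ᵀ := by
  ext j k
  change (simpleReflection i * Matrix.of cartan) j k = (Matrix.of cartan * (simpleReflection i)ᵀ) j k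
  revert i j k; decide +kernel

theorem vecMul_simpleReflection_twice (i : Fin 6) (γ : Fin 6 → ℤ) :
    (γ ᵥ* simpleReflection i) ᵥ* simpleReflection i = γ := by
  rw [Matrix.vecMul_vecMul, simpleReflection_mul_self, Matrix.vecMul_one]

theorem simpleRoot_mem (i : Fin 6) : simpleRoot i ∈ posRoots := by
  rw [posRoots, List.mem_toFinset]
  revert i; decide +kernel

theorem simpleRoot_vecMul (i : Fin 6) : simpleRoot i ᵥ* simpleReflection i = -simpleRoot i := by
  rw [vecMul_simpleReflection]
  revert i; decide +kernel

theorem vecMul_simpleReflection_mem {i : Fin 6} {γ : Fin 6 → ℤ} (hγ : γ ∈ posRoots)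
    (h : γ ≠ simpleRoot i) : γ ᵥ* simpleReflection i ∈ posRoots := by
  rw [vecMul_simpleReflection]
  rw [posRoots, List.mem_toFinset] at *
  have : ∀ γ ∈ posRootList, ∀ i, γ ≠ simpleRoot i → reflRoot i γ ∈ posRootList := by
    decide +kernel
  exact this γ hγ i h

theorem neg_notMem_posRoots {γ : Fin 6 → ℤ} (hγ : γ ∈ posRoots) : -γ ∉ posRoots := by
  rw [posRoots, List.mem_toFinset] at *
  have : ∀ γ ∈ posRootList, -γ ∉ posRootList := by decide +kernel
  exact this γ hγ

theorem card_posRoots : posRoots.card = 36 := by decide +kernel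

theorem vecMul_simpleReflection_ne {i : Fin 6} {γ : Fin 6 → ℤ} (hγ : γ ∈ posRoots) :
    γ ᵥ* simpleReflection i ≠ simpleRoot i := by
  intro h
  have := vecMul_simpleReflection_twice i γ
  rw [h, simpleRoot_vecMul] at this
  rw [← this] at hγ
  exact neg_notMem_posRoots (simpleRoot_mem i) hγ

theorem weylProd_cons (i : Fin 6) (l : List (Fin 6)) :
    weylProd (i :: l) = simpleReflection i * weylProd l := by simp [weylProd]

theorem weylProd_append (l l' : List (Fin 6)) :
    weylProd (l ++ l') = weylProd l * weylProd l' := by simp [weylProd]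

theorem vecMul_weylProd_mem_or {γ : Fin 6 → ℤ} (hγ : γ ∈ posRoots) (l : List (Fin 6)) :
    γ ᵥ* weylProd l ∈ posRoots ∨ -(γ ᵥ* weylProd l) ∈ posRoots := by
  induction l generalizing γ with
  | nil => left; simpa [weylProd] using hγ
  | cons i l ih =>
    rw [weylProd_cons, ← Matrix.vecMul_vecMul]
    by_cases h : γ = simpleRoot i
    · subst h
      rw [simpleRoot_vecMul, Matrix.neg_vecMul, neg_neg]
      exact (ih hγ).symm
    · exact ih (vecMul_simpleReflection_mem hγ h)

/-! ### Inversion sets, reducedness and the exchange condition -/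

/-- The positive roots made negative by `w⁻¹`. -/
def inversions (w : Matrix (Fin 6) (Fin 6) ℤ) : Finset (Fin 6 → ℤ) :=
  posRoots.filter fun γ => -(γ ᵥ* w) ∈ posRoots

theorem mem_inversions {w : Matrix (Fin 6) (Fin 6) ℤ} {γ : Fin 6 → ℤ} :
    γ ∈ inversions w ↔ γ ∈ posRoots ∧ -(γ ᵥ* w) ∈ posRoots := Finset.mem_filter

theorem mem_inversions_simpleReflection_mul {w : Matrix (Fin 6) (Fin 6) ℤ} {i : Fin 6}
    {γ : Fin 6 → ℤ} (hγ : γ ∈ posRoots) (h : γ ≠ simpleRoot i) :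
    γ ∈ inversions (simpleReflection i * w) ↔ γ ᵥ* simpleReflection i ∈ inversions w := by
  simp only [mem_inversions, hγ, vecMul_simpleReflection_mem hγ h, true_and,
    Matrix.vecMul_vecMul]

theorem simpleRoot_mem_inversions_iff {w : Matrix (Fin 6) (Fin 6) ℤ} {i : Fin 6} :
    simpleRoot i ∈ inversions (simpleReflection i * w) ↔ simpleRoot i ᵥ* w ∈ posRoots := by
  rw [mem_inversions, ← Matrix.vecMul_vecMul, simpleRoot_vecMul, Matrix.neg_vecMul, neg_neg]
  simp [simpleRoot_mem]

theorem inversions_simpleReflection_mul_subset (i : Fin 6) (w : Matrix (Fin 6) (Fin 6) ℤ) :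
    inversions (simpleReflection i * w) ⊆
      insert (simpleRoot i) ((inversions w).image (· ᵥ* simpleReflection i)) := by
  intro γ hγ
  rw [Finset.mem_insert, Finset.mem_image]
  by_cases h : γ = simpleRoot i
  · exact .inl h
  · exact .inr ⟨_, (mem_inversions_simpleReflection_mul (mem_inversions.mp hγ).1 h).mp hγ,
      vecMul_simpleReflection_twice i γ⟩

/-- When left multiplication by `s_i` lengthens `w`, exactly one inversion is added and the old ones
are moved by `s_i`. The induction for the signs runs along this recursion. -/
theorem inversions_simpleReflection_mul {i : Fin 6} {w : Matrix (Fin 6) (Fin 6) ℤ}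
    (h : simpleRoot i ᵥ* w ∈ posRoots) :
    inversions (simpleReflection i * w) =
      insert (simpleRoot i) ((inversions w).image (· ᵥ* simpleReflection i)) := by
  refine (inversions_simpleReflection_mul_subset i w).antisymm fun γ hγ => ?_
  rw [Finset.mem_insert, Finset.mem_image] at hγ
  obtain rfl | ⟨δ, hδ, rfl⟩ := hγ
  · exact simpleRoot_mem_inversions_iff.mpr h
  · have hδ' : δ ≠ simpleRoot i := by
      rintro rfl
      exact neg_notMem_posRoots h (mem_inversions.mp hδ).2
    have hpos := (mem_inversions.mp hδ).1
    rw [mem_inversions_simpleReflection_mul (vecMul_simpleReflection_mem hpos hδ')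
      (vecMul_simpleReflection_ne hpos), vecMul_simpleReflection_twice]
    exact hδ

theorem card_inversions_weylProd_le (l : List (Fin 6)) :
    (inversions (weylProd l)).card ≤ l.length := by
  induction l with
  | nil =>
    rw [List.length_nil, Nat.le_zero, Finset.card_eq_zero, Finset.eq_empty_iff_forall_notMem]
    intro γ hγ
    rw [mem_inversions] at hγ
    simp only [weylProd, List.map_nil, List.prod_nil, Matrix.vecMul_one] at hγ
    exact neg_notMem_posRoots hγ.1 hγ.2
  | cons i l ih =>
    rw [weylProd_cons, List.length_cons]
    calc _ ≤ _ := Finset.card_le_card (inversions_simpleReflection_mul_subset i _)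
      _ ≤ _ := Finset.card_insert_le _ _
      _ ≤ (inversions (weylProd l)).card + 1 := Nat.add_le_add_right Finset.card_image_le 1
      _ ≤ l.length + 1 := Nat.add_le_add_right ih 1

/-- No expression of an element is shorter than its number of inversions, so attaining that number
certifies minimality. -/
theorem isReducedExpr_of_length_le {l : List (Fin 6)}
    (h : l.length ≤ (inversions (weylProd l)).card) : IsReducedExpr l (weylProd l) :=
  ⟨rfl, fun l' hl' => h.trans (hl' ▸ card_inversions_weylProd_le l')⟩

theorem IsReducedExpr.of_append_left {l l' : List (Fin 6)}
    (h : IsReducedExpr (l ++ l') (weylProd (l ++ l'))) : IsReducedExpr l (weylProd l) := by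
  refine ⟨rfl, fun k hk => ?_⟩
  have := h.2 (k ++ l') (by rw [weylProd_append, weylProd_append, hk])
  simpa using this

theorem IsReducedExpr.of_cons {i : Fin 6} {l : List (Fin 6)}
    (h : IsReducedExpr (i :: l) (weylProd (i :: l))) : IsReducedExpr l (weylProd l) := by
  refine ⟨rfl, fun k hk => ?_⟩
  have := h.2 (i :: k) (by rw [weylProd_cons, weylProd_cons, hk])
  simpa using this

/-- The reflection in the root `β`. -/
def rootReflection (β : Fin 6 → ℤ) : Matrix (Fin 6) (Fin 6) ℤ :=
  1 - Matrix.vecMulVec (CartanMatrix.E₆ *ᵥ β) β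

theorem rootReflection_simpleRoot (i : Fin 6) :
    rootReflection (simpleRoot i) = simpleReflection i := by
  rw [rootReflection, simpleReflection]
  congr 1
  ext j k
  simp [Matrix.vecMulVec_apply, simpleRoot, Matrix.mulVec, dotProduct]

theorem rootReflection_mul_simpleReflection (β : Fin 6 → ℤ) (i : Fin 6) :
    rootReflection β * simpleReflection i =
      simpleReflection i * rootReflection (β ᵥ* simpleReflection i) := by
  have h : simpleReflection i *ᵥ (CartanMatrix.E₆ *ᵥ (β ᵥ* simpleReflection i)) =
      CartanMatrix.E₆ *ᵥ β := by
    rw [Matrix.mulVec_mulVec, simpleReflection_mul_cartan, ← Matrix.mulVec_mulVec,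
      Matrix.mulVec_transpose, vecMul_simpleReflection_twice]
  rw [rootReflection, rootReflection, Matrix.sub_mul, Matrix.mul_sub, Matrix.one_mul,
    Matrix.mul_one, Matrix.vecMulVec_mul, Matrix.mul_vecMulVec, h]

/-- The exchange condition. -/
theorem exists_weylProd_eq_rootReflection_mul (l : List (Fin 6)) {β : Fin 6 → ℤ}
    (hβ : β ∈ posRoots) (h : -(β ᵥ* weylProd l) ∈ posRoots) :
    ∃ l' : List (Fin 6), l'.length < l.length ∧ weylProd l' = rootReflection β * weylProd l := by
  induction l generalizing β with
  | nil =>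
    simp only [weylProd, List.map_nil, List.prod_nil, Matrix.vecMul_one] at h
    exact absurd h (neg_notMem_posRoots hβ)
  | cons j l ih =>
    -- If `β` is the root of the first letter, that letter cancels. Otherwise the reflection in `β`
    -- is moved past it and acts on the tail as the reflection in `s_j β`.
    by_cases hj : β = simpleRoot j
    · refine ⟨l, by simp, ?_⟩
      rw [hj, rootReflection_simpleRoot, weylProd_cons, ← Matrix.mul_assoc,
        simpleReflection_mul_self, Matrix.one_mul]
    · rw [weylProd_cons, ← Matrix.vecMul_vecMul] at h
      obtain ⟨l', hl, hl'⟩ := ih (vecMul_simpleReflection_mem hβ hj) h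
      refine ⟨j :: l', by simpa using hl, ?_⟩
      rw [weylProd_cons, hl', weylProd_cons, ← Matrix.mul_assoc, ← Matrix.mul_assoc,
        rootReflection_mul_simpleReflection]

/-- Otherwise the exchange condition writes `s_i w` with fewer letters than `l`, contradicting
reducedness of `i :: l`. -/
theorem IsReducedExpr.simpleRoot_vecMul_mem {i : Fin 6} {l : List (Fin 6)}
    (h : IsReducedExpr (i :: l) (weylProd (i :: l))) :
    simpleRoot i ᵥ* weylProd l ∈ posRoots := by
  refine (vecMul_weylProd_mem_or (simpleRoot_mem i) l).resolve_right fun hneg => ?_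
  obtain ⟨l', hl, hl'⟩ := exists_weylProd_eq_rootReflection_mul l (simpleRoot_mem i) hneg
  rw [rootReflection_simpleRoot, ← weylProd_cons] at hl'
  have := h.2 l' hl'
  simp only [List.length_cons] at this
  omega

/-! ### The action on the weights of the minuscule representation -/

/-- The images of a weight of `V(ω₁)` under the simple reflections `s_1, …, s_6`. -/
def PWt.reflTable : PWt → List PWt
  | .v0 => [.v0, .v0, .v0, .v0, .v0, .v1]
  | .v1 => [.v1, .v1, .v1, .v1, .v2, .v0]
  | .v2 => [.v2, .v2, .v2, .v3, .v1, .v2]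
  | .v3 => [.v3, .v4a, .v4b, .v2, .v3, .v3]
  | .v4a => [.v4a, .v3, .v5a, .v4a, .v4a, .v4a]
  | .v4b => [.v5b, .v5a, .v3, .v4b, .v4b, .v4b]
  | .v5a => [.v6b, .v4b, .v4a, .v6a, .v5a, .v5a]
  | .v5b => [.v4b, .v6b, .v5b, .v5b, .v5b, .v5b]
  | .v6a => [.v7b, .v6a, .v6a, .v5a, .v7a, .v6a]
  | .v6b => [.v5a, .v5b, .v6b, .v7b, .v6b, .v6b]
  | .v7a => [.v8a, .v7a, .v7a, .v7a, .v6a, .v8]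
  | .v7b => [.v6a, .v7b, .v8b, .v6b, .v8a, .v7b]
  | .v8 => [.v9a, .v8, .v8, .v8, .v8, .v7a]
  | .v8a => [.v7a, .v8a, .v9b, .v8a, .v7b, .v9a]
  | .v8b => [.v8b, .v8b, .v7b, .v8b, .v9b, .v8b]
  | .v9a => [.v8, .v9a, .v10a, .v9a, .v9a, .v8a]
  | .v9b => [.v9b, .v9b, .v8a, .v10b, .v8b, .v10a]
  | .v10a => [.v10a, .v10a, .v9a, .v11a, .v10a, .v9b]
  | .v10b => [.v10b, .v11b, .v10b, .v9b, .v10b, .v11a]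
  | .v11a => [.v11a, .v12b, .v11a, .v10a, .v12a, .v10b]
  | .v11b => [.v11b, .v10b, .v11b, .v11b, .v11b, .v12b]
  | .v12a => [.v12a, .v13, .v12a, .v12a, .v11a, .v12a]
  | .v12b => [.v12b, .v11a, .v12b, .v12b, .v13, .v11b]
  | .v13 => [.v13, .v12a, .v13, .v14, .v12b, .v13]
  | .v14 => [.v14, .v14, .v15, .v13, .v14, .v14]
  | .v15 => [.v16, .v15, .v14, .v15, .v15, .v15]
  | .v16 => [.v15, .v16, .v16, .v16, .v16, .v16]

/-- The simple reflection `s_i` on the weights of `V(ω₁)`. -/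
def PWt.refl (i : Fin 6) (v : PWt) : PWt := v.reflTable.getD i v

theorem refl_eq : ∀ (i : Fin 6) (v : PWt), v.refl i = ((v.down i).or (v.up i)).getD v := by
  decide +kernel

/-- The sign with which the representative of `s_i` acts on the basis vector of weight `v`. -/
def PWt.reflSign (i : Fin 6) (v : PWt) : ℤ := if (v.up i).isSome then -1 else 1

/-- The action of a word in the simple reflections on the weights of `V(ω₁)`. -/
def reflWord : List (Fin 6) → PWt → PWt
  | [], v => v
  | i :: l, v => (reflWord l v).refl i

/-- The sign with which a product of representatives of simple reflections acts. -/
def signWord : List (Fin 6) → PWt → ℤ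
  | [], _ => 1
  | i :: l, v => (reflWord l v).reflSign i * signWord l v

theorem wt_refl (i : Fin 6) (v : PWt) : (v.refl i).wt = simpleReflection i *ᵥ v.wt := by
  have : ∀ i v j, (PWt.refl i v).wt j = v.wt j - cartan j i * v.wt i := by decide +kernel
  ext j
  rw [this, simpleReflection, Matrix.sub_mulVec, Matrix.one_mulVec, Pi.sub_apply]
  simp [Matrix.mulVec, dotProduct, cartan]

theorem wt_reflWord (l : List (Fin 6)) (v : PWt) : (reflWord l v).wt = weylProd l *ᵥ v.wt := by
  induction l with
  | nil => simp [reflWord, weylProd]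
  | cons i l ih => rw [reflWord, wt_refl, ih, weylProd_cons, Matrix.mulVec_mulVec]

/-- The sign is read off the reflected weight through its pairing with a simple coroot, the form
that generalizes to a product over inversions. -/
theorem reflSign_eq (i : Fin 6) (v : PWt) :
    v.reflSign i = if simpleRoot i ⬝ᵥ (v.refl i).wt = 1 then -1 else 1 := by
  have h1 : ∀ i v, PWt.reflSign i v = if (v.refl i).wt i = 1 then -1 else 1 := by decide +kernel
  have h2 : simpleRoot i ⬝ᵥ (v.refl i).wt = (v.refl i).wt i := by
    simp [dotProduct, simpleRoot]
  rw [h1, h2]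

theorem wt_injective : Function.Injective PWt.wt := by
  have : ∀ v w : PWt, (∀ i, v.wt i = w.wt i) → v = w := by decide +kernel
  exact fun v w h => this v w (congrFun h)

/-- The sign with which the representative of `w` acts on a vector of weight `μ`. -/
def weylSign (w : Matrix (Fin 6) (Fin 6) ℤ) (μ : Fin 6 → ℤ) : ℤ :=
  ∏ γ ∈ inversions w, if γ ⬝ᵥ (w *ᵥ μ) = 1 then -1 else 1

/-- Each letter of a reduced word adds one inversion and contributes the factor of that root. Moving
the older roots by `s_i` leaves their pairings unchanged. The right-hand side does not mention the
word, so this takes the place of checking braid relations. -/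
theorem signWord_eq_weylSign {l : List (Fin 6)} (hl : IsReducedExpr l (weylProd l)) (v : PWt) :
    signWord l v = weylSign (weylProd l) v.wt := by
  induction l with
  | nil =>
    have := card_inversions_weylProd_le []
    rw [List.length_nil, Nat.le_zero, Finset.card_eq_zero] at this
    rw [weylSign, this]
    rfl
  | cons i l ih =>
    have hpos := hl.simpleRoot_vecMul_mem
    rw [signWord, ih hl.of_cons, weylProd_cons, weylSign, weylSign,
      inversions_simpleReflection_mul hpos,
      Finset.prod_insert, Finset.prod_image, reflSign_eq, wt_refl, wt_reflWord,
      Matrix.mulVec_mulVec]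
    · congr 1
      refine Finset.prod_congr rfl fun γ _ => ?_
      rw [← Matrix.dotProduct_mulVec, Matrix.mulVec_mulVec, ← Matrix.mul_assoc,
        simpleReflection_mul_self, Matrix.one_mul]
    · intro a _ b _ hab
      rw [← vecMul_simpleReflection_twice i a, ← vecMul_simpleReflection_twice i b]
      exact congrArg (· ᵥ* simpleReflection i) hab
    · rw [Finset.mem_image]
      rintro ⟨γ, hγ, h⟩
      exact vecMul_simpleReflection_ne (mem_inversions.mp hγ).1 h

/-- The six weights span the weight space over ℚ, which suffices for integral matrices. They do not
generate the weight lattice: the fourth and fifth yield only `2 ω₅`. -/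
theorem matrix_ext_of_wt {A B : Matrix (Fin 6) (Fin 6) ℤ}
    (h : ∀ v ∈ [PWt.v16, .v15, .v14, .v13, .v12a, .v0], A *ᵥ v.wt = B *ᵥ v.wt) : A = B := by
  have hw : PWt.v16.wt = ![1, 0, 0, 0, 0, 0] ∧ PWt.v15.wt = ![-1, 0, 1, 0, 0, 0] ∧
      PWt.v14.wt = ![0, 0, -1, 1, 0, 0] ∧ PWt.v13.wt = ![0, 1, 0, -1, 1, 0] ∧
      PWt.v12a.wt = ![0, -1, 0, 0, 1, 0] ∧ PWt.v0.wt = ![0, 0, 0, 0, 0, -1] := by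
    decide +kernel
  obtain ⟨h1, h2, h3, h4, h5, h6⟩ := hw
  ext i j
  have e1 := congrFun (h .v16 (by simp)) i
  have e2 := congrFun (h .v15 (by simp)) i
  have e3 := congrFun (h .v14 (by simp)) i
  have e4 := congrFun (h .v13 (by simp)) i
  have e5 := congrFun (h .v12a (by simp)) i
  have e6 := congrFun (h .v0 (by simp)) i
  simp only [h1, h2, h3, h4, h5, h6, Matrix.mulVec, dotProduct, Fin.sum_univ_six] at e1 e2 e3 e4 e5 e6
  simp at e1 e2 e3 e4 e5 e6
  fin_cases j <;> simp <;> omega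

/-! ### Representatives of Weyl group elements -/

theorem minuscule_x_bvec (i : Fin 6) (a : ℂ) (v : PWt) :
    expo (a • minuscule.E i) (bvec v) = bvec v + a • obvec (v.up i) := by
  rw [expo_of_sq_eq_zero]
  · simp only [LinearMap.add_apply, LinearMap.smul_apply, Module.End.one_apply]
    rw [← eMat_mulVec_bvec]
    rfl
  · have : minuscule.E i * minuscule.E i = 0 := by
      change Matrix.toLin' (eMat i) * Matrix.toLin' (eMat i) = 0
      rw [Module.End.mul_eq_comp, ← Matrix.toLin'_mul, eMat_mul_self, map_zero]
    simp [this]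

theorem minuscule_y_bvec (i : Fin 6) (a : ℂ) (v : PWt) :
    expo (a • minuscule.F i) (bvec v) = bvec v + a • obvec (v.down i) := by
  rw [expo_of_sq_eq_zero]
  · simp only [LinearMap.add_apply, LinearMap.smul_apply, Module.End.one_apply]
    rw [← fMat_mulVec_bvec]
    rfl
  · have : minuscule.F i * minuscule.F i = 0 := by
      change Matrix.toLin' (fMat i) * Matrix.toLin' (fMat i) = 0
      rw [Module.End.mul_eq_comp, ← Matrix.toLin'_mul, fMat_mul_self, map_zero]
    simp [this]

/-- `minuscule` is the defining representation of `G`, so equalities in `G` can be tested on the 27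
basis vectors. -/
theorem toLin'_wordG (w : Word) :
    Matrix.toLin' ((wordG w : (Matrix PWt PWt ℂ)ˣ) : Matrix PWt PWt ℂ) = minuscule.act w := by
  induction w with
  | nil => exact Matrix.toLin'_one
  | cons s w ih =>
    have hw : wordG (s :: w) = cond s.1 (x s.2.1 s.2.2) (y s.2.1 s.2.2) * wordG w := by
      simp [wordG]
    rw [hw, ChevalleyRep.act_cons, Subgroup.coe_mul, Units.val_mul, Matrix.toLin'_mul, ih,
      ← Module.End.mul_eq_comp]
    congr 1
    have key : ∀ T : Matrix PWt PWt ℂ, T * T = 0 → ∀ a : ℂ,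
        Matrix.toLin' (expo (a • T)) = expo (a • Matrix.toLin' T) := by
      intro T hT a
      rw [← map_smul]
      exact (expo_map (T := a • T) ⟨2, by simp [pow_two, hT]⟩
        (Matrix.toLinAlgEquiv' (R := ℂ) (n := PWt)).toAlgHom).symm
    rcases s with ⟨_ | _, i, a⟩
    · exact key _ (fMat_mul_self i) a
    · exact key _ (eMat_mul_self i) a

/-- The word of a product of the representatives `sBar i`. -/
def barWord (l : List (Fin 6)) : Word :=
  l.flatMap fun i => [(true, i, -1), (false, i, 1), (true, i, -1)]

theorem wordG_barWord (l : List (Fin 6)) : wordG (barWord l) = (l.map sBar).prod := by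
  induction l with
  | nil => rfl
  | cons i l ih =>
    rw [barWord, List.flatMap_cons, wordG_append, List.map_cons, List.prod_cons, ← ih]
    congr 1
    simp [wordG, sBar, mul_assoc]

theorem act_barWord_cons (i : Fin 6) (l : List (Fin 6)) {M : Type*} [AddCommGroup M] [Module ℂ M]
    (R : ChevalleyRep M) : R.act (barWord (i :: l)) =
      expo ((-1 : ℂ) • R.E i) * expo ((1 : ℂ) • R.F i) * expo ((-1 : ℂ) • R.E i) *
        R.act (barWord l) := by
  rw [barWord, List.flatMap_cons, ChevalleyRep.act_append]
  simp [ChevalleyRep.act_cons, mul_assoc, barWord]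

/-- This reduces to SL₂: all `i`-strings have length at most two, and on a string `v → f_i v` the
representative sends `v` to `f_i v` and `f_i v` to `-v`. -/
theorem act_barWord (l : List (Fin 6)) (v : PWt) :
    minuscule.act (barWord l) (bvec v) = (signWord l v : ℂ) • bvec (reflWord l v) := by
  induction l with
  | nil => simp [barWord, signWord, reflWord]
  | cons i l ih =>
    rw [act_barWord_cons, Module.End.mul_apply, ih, map_smul, signWord, reflWord]
    generalize reflWord l v = u
    have hu : (expo ((-1 : ℂ) • minuscule.E i) * expo ((1 : ℂ) • minuscule.F i) *
        expo ((-1 : ℂ) • minuscule.E i)) (bvec u) = (u.reflSign i : ℂ) • bvec (u.refl i) := by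
      simp only [Module.End.mul_apply, minuscule_x_bvec]
      rcases hup : u.up i with _ | t
      · rcases hd : u.down i with _ | t
        · simp only [minuscule_x_bvec, minuscule_y_bvec, obvec_none, smul_zero, add_zero, hup, hd,
            PWt.reflSign, refl_eq]
          simp
        · have ht := down_eq_some_iff.mp hd
          simp only [minuscule_x_bvec, minuscule_y_bvec, map_add, map_smul, obvec_some, obvec_none,
            smul_zero, add_zero, hup, hd, ht, PWt.reflSign, refl_eq]
          simp
      · have ht := down_eq_some_iff.mpr hup
        have ht' := up_eq_none_of_down ht
        have hd : u.down i = none := by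
          by_contra hd
          obtain ⟨w, hw⟩ := Option.ne_none_iff_exists'.mp hd
          rw [up_eq_none_of_down hw] at hup
          cases hup
        simp only [minuscule_x_bvec, minuscule_y_bvec, map_add, map_smul, obvec_some, obvec_none,
          smul_zero, add_zero, hup, hd, ht, ht', PWt.reflSign, refl_eq]
        simp
    rw [hu, smul_smul, Int.cast_mul, mul_comm]

/-- The word hidden in the `epsilon` and the given one are both reduced. They permute the weights in
the same way because weights determine basis vectors, and with the same signs by
`signWord_eq_weylSign`. -/
theorem bar_eq {l : List (Fin 6)} {w : Matrix (Fin 6) (Fin 6) ℤ} (hl : IsReducedExpr l w) :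
    bar w = wordG (barWord l) := by
  obtain ⟨k, hk, hbar⟩ := Classical.epsilon_spec
    (p := fun g : G => ∃ l, IsReducedExpr l w ∧ g = (l.map sBar).prod) ⟨_, l, hl, rfl⟩
  have hb : bar w = wordG (barWord k) := hbar.trans (wordG_barWord k).symm
  rw [hb]
  refine Subtype.ext (Units.ext (Matrix.toLin'.injective ?_))
  rw [toLin'_wordG, toLin'_wordG]
  refine end_ext fun v => ?_
  obtain ⟨rfl, -⟩ := id hk
  have hkl := hl.1
  rw [← hkl] at hl
  have hr : reflWord k v = reflWord l v :=
    wt_injective (by rw [wt_reflWord, wt_reflWord, hkl])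
  rw [act_barWord, act_barWord, signWord_eq_weylSign hk, signWord_eq_weylSign hl, hkl, hr]

end

noncomputable section

open TensorProduct

/-! ### Highest weight vectors in tensor products of minuscule representations -/

namespace ChevalleyRep

variable {M M' : Type*} [AddCommGroup M] [Module ℂ M] [AddCommGroup M'] [Module ℂ M']

theorem HasWt.add {R : ChevalleyRep M} {μ : Fin 6 → ℂ} {a b : M} (ha : R.HasWt a μ)
    (hb : R.HasWt b μ) : R.HasWt (a + b) μ := fun j => by rw [map_add, ha j, hb j, smul_add]

theorem HasWt.sub {R : ChevalleyRep M} {μ : Fin 6 → ℂ} {a b : M} (ha : R.HasWt a μ)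
    (hb : R.HasWt b μ) : R.HasWt (a - b) μ := fun j => by rw [map_sub, ha j, hb j, smul_sub]

/-- The antisymmetrization of `a ⊗ b`. -/
def wedge₂ (a b : M) : M ⊗[ℂ] M := a ⊗ₜ b - b ⊗ₜ a

/-- A raising operator replaces `b` by a multiple of `a`, and `a ∧ a = 0`. -/
theorem IsHighest.wedge₂ {R : ChevalleyRep M} {μ ν : Fin 6 → ℂ} {a b : M} {c : Fin 6 → ℂ}
    (ha : R.IsHighest μ a) (hb : R.HasWt b ν) (hb' : ∀ j, R.E j b = c j • a) :
    (R.tensor R).IsHighest (μ + ν) (wedge₂ a b) where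
  E_apply j := by
    simp only [ChevalleyRep.wedge₂, map_sub, tensor_E_tmul, ha.E_apply, hb', zero_tmul, tmul_zero,
      zero_add, add_zero, tmul_smul, smul_tmul, sub_self]
  weight := (ha.weight.tmul hb).sub (add_comm ν μ ▸ hb.tmul ha.weight)

/-- The antisymmetrization of `a ⊗ b ⊗ c`. -/
def wedge₃ (a b c : M) : M ⊗[ℂ] (M ⊗[ℂ] M) :=
  a ⊗ₜ wedge₂ b c + b ⊗ₜ wedge₂ c a + c ⊗ₜ wedge₂ a b

/-- Here too a raising operator can only create a repeated factor: `b` becomes a multiple of `a`, or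
`c` a multiple of `b`. -/
theorem IsHighest.wedge₃ {R : ChevalleyRep M} {μ ν κ : Fin 6 → ℂ} {a b c : M} {s t : Fin 6 → ℂ}
    (ha : R.IsHighest μ a) (hb : R.HasWt b ν) (hb' : ∀ j, R.E j b = s j • a)
    (hc : R.HasWt c κ) (hc' : ∀ j, R.E j c = t j • b) :
    (R.tensor (R.tensor R)).IsHighest (μ + ν + κ) (wedge₃ a b c) where
  E_apply j := by
    simp only [ChevalleyRep.wedge₃, ChevalleyRep.wedge₂, map_sub, map_add, tensor_E_tmul,
      ha.E_apply, hb', hc', tmul_sub, zero_tmul, tmul_zero, zero_add, add_zero, tmul_smul,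
      smul_tmul, tmul_add]
    abel
  weight := by
    have h2 : ∀ {a b : M} {μ ν : Fin 6 → ℂ}, R.HasWt a μ → R.HasWt b ν →
        (R.tensor R).HasWt (ChevalleyRep.wedge₂ a b) (μ + ν) := fun {_ _ μ ν} ha hb =>
      (ha.tmul hb).sub (add_comm ν μ ▸ hb.tmul ha)
    have e1 := ha.weight.tmul (h2 hb hc)
    have e2 := hb.tmul (h2 hc ha.weight)
    have e3 := hc.tmul (h2 ha.weight hb)
    rw [show ν + (κ + μ) = μ + (ν + κ) by abel] at e2
    rw [show κ + (μ + ν) = μ + (ν + κ) by abel] at e3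
    rw [add_assoc]
    exact (e1.add e2).add e3

end ChevalleyRep

open ChevalleyRep

theorem minuscule_hasWt (v : PWt) : minuscule.HasWt (bvec v) fun j => (v.wt j : ℂ) :=
  fun j => hMat_bvec j v

theorem minuscule_twist_hasWt (v : PWt) :
    minuscule.twist.HasWt (bvec v) fun j => (v.wt (dynkinSymm j) : ℂ) :=
  fun j => hMat_bvec (dynkinSymm j) v

theorem minuscule_E_eq_zero {v : PWt} (h : ∀ j, v.up j = none) (j : Fin 6) :
    minuscule.E j (bvec v) = 0 := by
  rw [← obvec_none, ← h j]
  exact eMat_mulVec_bvec j v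

theorem minuscule_E_eq {v w : PWt} {i : Fin 6} (h : ∀ j, v.up j = if j = i then some w else none)
    (j : Fin 6) : minuscule.E j (bvec v) = (if j = i then 1 else 0 : ℂ) • bvec w := by
  have := eMat_mulVec_bvec j v
  rw [h j] at this
  refine this.trans ?_
  split_ifs <;> simp

theorem minuscule_twist_E_eq {v w : PWt} {i : Fin 6}
    (h : ∀ j, v.up (dynkinSymm j) = if j = i then some w else none)
    (j : Fin 6) : minuscule.twist.E j (bvec v) = (if j = i then 1 else 0 : ℂ) • bvec w := by
  have := eMat_mulVec_bvec (dynkinSymm j) v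
  rw [h j] at this
  refine this.trans ?_
  split_ifs <;> simp

/-- The coordinate functional of the weight `v`. -/
abbrev coord (v : PWt) : (PWt → ℂ) →ₗ[ℂ] ℂ := LinearMap.proj v

theorem minuscule_isWtFunctional (v : PWt) :
    minuscule.IsWtFunctional (fun j => (v.wt j : ℂ)) (coord v) := by
  intro j z
  change Matrix.mulVec (hMat j) z v = _
  rw [hMat, Matrix.mulVec_diagonal]
  rfl

theorem minuscule_twist_isWtFunctional (v : PWt) :
    minuscule.twist.IsWtFunctional (fun j => (v.wt (dynkinSymm j) : ℂ)) (coord v) :=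
  fun j => minuscule_isWtFunctional v (dynkinSymm j)

/-- The matrix entry of a word in the representation `V(ω₁)`. -/
def entry (w : Word) (u v : PWt) : ℂ := minuscule.act w (bvec v) u

section Models

variable {V : Type*} [AddCommGroup V] [Module ℂ V] [LieRingModule 𝔤 V] [LieModule ℂ 𝔤 V]
  {ρ : Representation ℂ G V} {v : V}

theorem fundWeight_eq {i : Fin 6} {μ : Fin 6 → ℤ} (h : ∀ j, μ j = if j = i then 1 else 0) :
    (fun j => (μ j : ℂ)) = fundWeight i := by
  ext j
  rw [h j, fundWeight]
  split_ifs <;> simp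

theorem up_v16 : ∀ j, PWt.v16.up j = none := by decide +kernel

theorem minuscule_isHighest : minuscule.IsHighest (fun j => (PWt.v16.wt j : ℂ)) (bvec .v16) :=
  ⟨minuscule_E_eq_zero up_v16, minuscule_hasWt _⟩

theorem minuscule_twist_isHighest :
    minuscule.twist.IsHighest (fun j => (PWt.v16.wt (dynkinSymm j) : ℂ)) (bvec .v16) :=
  ⟨fun j => minuscule_E_eq_zero up_v16 (dynkinSymm j), minuscule_twist_hasWt _⟩

theorem hwCoeff_fund_one (h : IsFundamentalRep 0 ρ v) (w : Word) :
    hwCoeff 0 v (ρ (wordG w) v) = entry w .v16 .v16 := by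
  have hw : (fun j => (PWt.v16.wt j : ℂ)) = fundWeight 0 := fundWeight_eq (by decide +kernel)
  exact h.hwCoeff_eq minuscule (hw ▸ minuscule_isHighest) (hw ▸ minuscule_isWtFunctional .v16)
    (by simp) w

theorem hwCoeff_fund_six (h : IsFundamentalRep 5 ρ v) (w : Word) :
    hwCoeff 5 v (ρ (wordG w) v) = entry (twistWord w) .v16 .v16 := by
  have hw : (fun j => (PWt.v16.wt (dynkinSymm j) : ℂ)) = fundWeight 5 :=
    fundWeight_eq (by decide +kernel)
  rw [h.hwCoeff_eq minuscule.twist (hw ▸ minuscule_twist_isHighest)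
    (hw ▸ minuscule_twist_isWtFunctional .v16) (by simp) w, act_twist]
  rfl

/-- The vector `v16 ∧ v15` has weight ω₃, and the functional dual to `v16 ⊗ v15` extracts a 2 × 2
minor. -/
theorem hwCoeff_fund_three (h : IsFundamentalRep 2 ρ v) (w : Word) :
    hwCoeff 2 v (ρ (wordG w) v) =
      entry w .v16 .v16 * entry w .v15 .v15 - entry w .v16 .v15 * entry w .v15 .v16 := by
  have hw : (fun j => (PWt.v16.wt j : ℂ)) + (fun j => (PWt.v15.wt j : ℂ)) = fundWeight 2 := by
    rw [← fundWeight_eq (μ := fun j => PWt.v16.wt j + PWt.v15.wt j) (by decide +kernel)]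
    ext j
    simp
  rw [h.hwCoeff_eq (minuscule.tensor minuscule)
    (hw ▸ minuscule_isHighest.wedge₂ (minuscule_hasWt .v15)
      (minuscule_E_eq (i := 0) (by decide +kernel)))
    (hw ▸ (minuscule_isWtFunctional .v16).tmul (minuscule_isWtFunctional .v15))
    (by simp [wedge₂]) w]
  simp only [wedge₂, map_sub, act_tensor, functionalTmul_tmul]
  rfl

theorem hwCoeff_fund_five (h : IsFundamentalRep 4 ρ v) (w : Word) :
    hwCoeff 4 v (ρ (wordG w) v) =
      entry (twistWord w) .v16 .v16 * entry (twistWord w) .v15 .v15 -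
        entry (twistWord w) .v16 .v15 * entry (twistWord w) .v15 .v16 := by
  have hw : (fun j => (PWt.v16.wt (dynkinSymm j) : ℂ)) +
      (fun j => (PWt.v15.wt (dynkinSymm j) : ℂ)) = fundWeight 4 := by
    rw [← fundWeight_eq (μ := fun j => PWt.v16.wt (dynkinSymm j) + PWt.v15.wt (dynkinSymm j))
      (by decide +kernel)]
    ext j
    simp
  rw [h.hwCoeff_eq (minuscule.twist.tensor minuscule.twist)
    (hw ▸ minuscule_twist_isHighest.wedge₂ (minuscule_twist_hasWt .v15)
      (minuscule_twist_E_eq (i := 5) (by decide +kernel)))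
    (hw ▸ (minuscule_twist_isWtFunctional .v16).tmul (minuscule_twist_isWtFunctional .v15))
    (by simp [wedge₂]) w]
  simp only [wedge₂, map_sub, act_tensor, functionalTmul_tmul, act_twist]
  rfl

/-- In the twisted representation `v16 ∧ v15 ∧ v14` has weight ω₄; the result is a 3 × 3
determinant. -/
theorem hwCoeff_fund_four (h : IsFundamentalRep 3 ρ v) (w : Word) :
    hwCoeff 3 v (ρ (wordG w) v) =
      entry (twistWord w) .v16 .v16 *
        (entry (twistWord w) .v15 .v15 * entry (twistWord w) .v14 .v14 -
          entry (twistWord w) .v15 .v14 * entry (twistWord w) .v14 .v15) +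
      entry (twistWord w) .v16 .v15 *
        (entry (twistWord w) .v15 .v14 * entry (twistWord w) .v14 .v16 -
          entry (twistWord w) .v15 .v16 * entry (twistWord w) .v14 .v14) +
      entry (twistWord w) .v16 .v14 *
        (entry (twistWord w) .v15 .v16 * entry (twistWord w) .v14 .v15 -
          entry (twistWord w) .v15 .v15 * entry (twistWord w) .v14 .v16) := by
  have hw : (fun j => (PWt.v16.wt (dynkinSymm j) : ℂ)) +
      (fun j => (PWt.v15.wt (dynkinSymm j) : ℂ)) +
      (fun j => (PWt.v14.wt (dynkinSymm j) : ℂ)) = fundWeight 3 := by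
    rw [← fundWeight_eq (μ := fun j => PWt.v16.wt (dynkinSymm j) + PWt.v15.wt (dynkinSymm j) +
      PWt.v14.wt (dynkinSymm j)) (by decide +kernel)]
    ext j
    simp
  have hξ := (minuscule_twist_isWtFunctional .v16).tmul
    ((minuscule_twist_isWtFunctional .v15).tmul (minuscule_twist_isWtFunctional .v14))
  rw [← add_assoc] at hξ
  rw [h.hwCoeff_eq (minuscule.twist.tensor (minuscule.twist.tensor minuscule.twist))
    (hw ▸ minuscule_twist_isHighest.wedge₃ (minuscule_twist_hasWt .v15)
      (minuscule_twist_E_eq (i := 5) (by decide +kernel)) (minuscule_twist_hasWt .v14)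
      (minuscule_twist_E_eq (i := 4) (by decide +kernel)))
    (hw ▸ hξ) (by simp [wedge₂, wedge₃, tmul_sub]) w]
  simp only [wedge₂, wedge₃, map_sub, map_add, act_tensor, functionalTmul_tmul, act_twist]
  rfl

/-- The path from `v16` to `v11b` has labels 1, 3, 4, 5, 6, and in the twist 6, 5, 4, 3, 1. Pairing
one path with the reverse of the other gives six tensors of weight ω₂. With alternating signs, the
two terms that each raising operator produces from neighbours cancel. -/
theorem hwCoeff_fund_two (h : IsFundamentalRep 1 ρ v) (w : Word) :
    hwCoeff 1 v (ρ (wordG w) v) =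
      entry w .v16 .v16 * entry (twistWord w) .v11b .v11b -
      entry w .v16 .v15 * entry (twistWord w) .v11b .v12b +
      entry w .v16 .v14 * entry (twistWord w) .v11b .v13 -
      entry w .v16 .v13 * entry (twistWord w) .v11b .v14 +
      entry w .v16 .v12b * entry (twistWord w) .v11b .v15 -
      entry w .v16 .v11b * entry (twistWord w) .v11b .v16 := by
  have hw : ∀ a b : PWt, (∀ j, a.wt j + b.wt (dynkinSymm j) = if j = 1 then 1 else 0) →
      (fun j => (a.wt j : ℂ)) + (fun j => (b.wt (dynkinSymm j) : ℂ)) = fundWeight 1 := by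
    intro a b hab
    rw [← fundWeight_eq hab]
    ext j
    simp
  have hwt : ∀ a b : PWt, (∀ j, a.wt j + b.wt (dynkinSymm j) = if j = 1 then 1 else 0) →
      (minuscule.tensor minuscule.twist).HasWt (bvec a ⊗ₜ bvec b) (fundWeight 1) := fun a b hab =>
    hw a b hab ▸ (minuscule_hasWt a).tmul (minuscule_twist_hasWt b)
  set m : (PWt → ℂ) ⊗[ℂ] (PWt → ℂ) :=
    bvec .v16 ⊗ₜ bvec .v11b - bvec .v15 ⊗ₜ bvec .v12b + bvec .v14 ⊗ₜ bvec .v13 -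
      bvec .v13 ⊗ₜ bvec .v14 + bvec .v12b ⊗ₜ bvec .v15 - bvec .v11b ⊗ₜ bvec .v16 with hm
  have hhigh : (minuscule.tensor minuscule.twist).IsHighest (fundWeight 1) m := by
    refine ⟨fun j => ?_, ?_⟩
    · simp only [hm, map_sub, map_add, tensor_E_tmul, minuscule_isHighest.E_apply,
        minuscule_twist_isHighest.E_apply,
        minuscule_E_eq (v := .v15) (w := .v16) (i := 0) (by decide +kernel),
        minuscule_E_eq (v := .v14) (w := .v15) (i := 2) (by decide +kernel),
        minuscule_E_eq (v := .v13) (w := .v14) (i := 3) (by decide +kernel),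
        minuscule_E_eq (v := .v12b) (w := .v13) (i := 4) (by decide +kernel),
        minuscule_E_eq (v := .v11b) (w := .v12b) (i := 5) (by decide +kernel),
        minuscule_twist_E_eq (v := .v15) (w := .v16) (i := 5) (by decide +kernel),
        minuscule_twist_E_eq (v := .v14) (w := .v15) (i := 4) (by decide +kernel),
        minuscule_twist_E_eq (v := .v13) (w := .v14) (i := 3) (by decide +kernel),
        minuscule_twist_E_eq (v := .v12b) (w := .v13) (i := 2) (by decide +kernel),
        minuscule_twist_E_eq (v := .v11b) (w := .v12b) (i := 0) (by decide +kernel),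
        zero_tmul, tmul_zero, tmul_smul, smul_tmul]
      abel
    · exact (((((hwt _ _ (by decide +kernel)).sub (hwt _ _ (by decide +kernel))).add
        (hwt _ _ (by decide +kernel))).sub (hwt _ _ (by decide +kernel))).add
        (hwt _ _ (by decide +kernel))).sub (hwt _ _ (by decide +kernel))
  rw [h.hwCoeff_eq (minuscule.tensor minuscule.twist) hhigh
    (hw .v16 .v11b (by decide +kernel) ▸
      (minuscule_isWtFunctional .v16).tmul (minuscule_twist_isWtFunctional .v11b))
    (by simp [hm]) w]
  simp only [hm, map_sub, map_add, act_tensor, functionalTmul_tmul, act_twist]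
  rfl

end Models

end

noncomputable section

open ChevalleyRep

/-! ### Words for the reduced expressions -/

/-- A reduced expression of `u_{≥ m} w₀`, namely `s_{σ(r_1)} ⋯ s_{σ(r_{m-1})}`. -/
def seedWord (m : ℕ) : List (Fin 6) := (w0Word.reverse.take (m - 1)).map dynkinSymm

theorem weylProd_eq_of_reflWord {l l' : List (Fin 6)}
    (h : ∀ v ∈ [PWt.v16, .v15, .v14, .v13, .v12a, .v0], reflWord l v = reflWord l' v) :
    weylProd l = weylProd l' :=
  matrix_ext_of_wt fun v hv => by rw [← wt_reflWord, ← wt_reflWord, h v hv]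

theorem vecMul_w0 (γ : Fin 6 → ℤ) : Matrix.vecMul γ w0 = -(γ ∘ dynkinSymm) := by
  have h : w0 = -(1 : Matrix (Fin 6) (Fin 6) ℤ).submatrix dynkinSymm id := by
    -- The longest element is minus the diagram symmetry, so it sends every positive root to a
    -- negative one.
    refine matrix_ext_of_wt fun v _ => ?_
    have hv : ∀ v i, (reflWord w0Word v).wt i = -v.wt (dynkinSymm i) := by decide +kernel
    rw [w0, ← wt_reflWord]
    ext i
    rw [hv]
    simp [Matrix.mulVec, dotProduct, Matrix.one_apply]
  have hσ : ∀ i j, dynkinSymm i = j ↔ i = dynkinSymm j := by decide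
  rw [h]
  ext j
  simp [Matrix.vecMul, dotProduct, Matrix.one_apply, hσ]

theorem inversions_w0 : inversions w0 = posRoots := by
  refine Finset.filter_true_of_mem fun γ hγ => ?_
  rw [vecMul_w0, neg_neg]
  rw [posRoots, List.mem_toFinset] at *
  have : ∀ γ ∈ posRootList, γ ∘ dynkinSymm ∈ posRootList := by decide +kernel
  exact this γ hγ

theorem isReducedExpr_w0Word : IsReducedExpr w0Word w0 :=
  isReducedExpr_of_length_le (by
    change _ ≤ (inversions w0).card
    rw [inversions_w0, card_posRoots]
    decide)

/-- Reversing the word of `w₀` and applying the diagram symmetry gives another 36-letter word for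
`w₀`; `seedWord m` is a prefix of it. -/
theorem isReducedExpr_seedWord (m : ℕ) : IsReducedExpr (seedWord m) (weylProd (seedWord m)) := by
  have hfull : weylProd (w0Word.reverse.map dynkinSymm) = w0 :=
    weylProd_eq_of_reflWord (by decide +kernel)
  have hred : IsReducedExpr (w0Word.reverse.map dynkinSymm)
      (weylProd (w0Word.reverse.map dynkinSymm)) := by
    refine isReducedExpr_of_length_le ?_
    rw [hfull, inversions_w0, card_posRoots]
    decide
  refine IsReducedExpr.of_append_left (l' := (w0Word.reverse.drop (m - 1)).map dynkinSymm) ?_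
  rw [seedWord, ← List.map_append, List.take_append_drop]
  exact hred

/-- The indices of the cluster variables. -/
def seedIdx : List ℕ := [6, 7, 8, 10, 11, 12, 13, 14, 15, 16, 17, 18, 19, 20, 21, 42]

/-- Since `w₀` is an involution, `w₀ u_{≥ m}` is the product of the letters `r_1, …, r_{m-1}`, and
conjugation by `w₀` applies the diagram symmetry to the letters. For `m = 42`, truncated subtraction
makes `u_{≥ m}` the empty product, and `seedWord` contains all 36 letters. -/
theorem uGE_mul_w0 {m : ℕ} (hm : m ∈ seedIdx) : uGE m * w0 = weylProd (seedWord m) := by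
  rw [uGE, w0, ← weylProd_append]
  refine weylProd_eq_of_reflWord ?_
  have : ∀ m ∈ seedIdx, ∀ v ∈ [PWt.v16, .v15, .v14, .v13, .v12a, .v0],
      reflWord (w0Word.take (37 - m) ++ w0Word) v =
      reflWord (seedWord m) v := by decide +kernel
  exact this m hm

theorem bar_uGE_mul_w0 {m : ℕ} (hm : m ∈ seedIdx) :
    bar (uGE m * w0) = wordG (barWord (seedWord m)) :=
  bar_eq (uGE_mul_w0 hm ▸ isReducedExpr_seedWord m)

theorem bar_one : bar 1 = 1 :=
  bar_eq (l := []) ⟨rfl, fun _ _ => Nat.zero_le _⟩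

theorem w0_mul_w0 : w0 * w0 = 1 := by
  have := weylProd_eq_of_reflWord (l := w0Word ++ w0Word) (l' := []) (by decide +kernel)
  rw [weylProd_append] at this
  exact this

theorem transpose_mul (g g' : G) : transpose (g * g') = transpose g' * transpose g :=
  Subtype.ext (Units.ext (Matrix.transpose_mul _ _))

theorem transpose_reverse_prod (l : List G) :
    transpose l.reverse.prod = (l.map transpose).prod := by
  induction l with
  | nil => exact Subtype.ext (Units.ext Matrix.transpose_one)
  | cons g l ih => simp [transpose_mul, ih]

/-- A word in the one-parameter subgroups `x_i`, with labels for the parameters. -/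
abbrev LabelledWord : Type := List (Fin 6 × Fin 16)

/-- The substitution of parameters into a labelled word. -/
def LabelledWord.subst (a : Fin 16 → ℂ) (l : LabelledWord) : Word :=
  l.map fun s => (true, s.1, a s.2)

/-- The labelled word of the transpose of an element of the torus. -/
def torusWord : LabelledWord :=
  [(0, 0), (2, 1), (3, 2), (1, 3), (4, 4), (3, 5), (2, 6), (0, 7), (5, 8), (4, 9), (3, 10),
    (2, 11), (1, 12), (3, 13), (4, 14), (5, 15)]

/-- The twist of `torusWord` by the symmetry of the Dynkin diagram. -/
def torusWordTwist : LabelledWord := torusWord.map fun s => (dynkinSymm s.1, s.2)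

theorem transpose_torusElt (a : Fin 16 → ℂ) :
    transpose (torusElt a) = wordG (torusWord.subst a) := by
  have h : torusWord = List.ofFn fun k : Fin 16 => (r (k + 1), k) := by decide +kernel
  rw [torusElt, transpose_reverse_prod, wordG, LabelledWord.subst, h]
  simp only [List.map_ofFn]
  congr 2
  funext k
  exact Subtype.ext (transposeGL_yGL _ _)

/-- The second weight is moved by `w₀`, so the left representative belongs to `w₀ w₀ = 1` and
disappears; only right translation by `u_{≥ m} w₀` remains. -/
theorem phi_torusElt {V : Fin 6 → Type*} [∀ i, AddCommGroup (V i)] [∀ i, Module ℂ (V i)]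
    [∀ i, LieRingModule 𝔤 (V i)] [∀ i, LieModule ℂ 𝔤 (V i)]
    (ρ : ∀ i, Representation ℂ G (V i)) (v : ∀ i, V i) {m : ℕ} (hm : m ∈ seedIdx) {j : Fin 6}
    (hj : dynkinSymm (r m) = j) (a : Fin 16 → ℂ) :
    phi ρ v m (torusElt a) =
      hwCoeff j (v j) (ρ j (wordG (torusWord.subst a ++ barWord (seedWord m))) (v j)) := by
  subst hj
  rw [phi, minorT, minor, w0_mul_w0, bar_one, bar_uGE_mul_w0 hm, transpose_torusElt, inv_one,
    one_mul, wordG_append]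

theorem entry_append_barWord (w : Word) (l : List (Fin 6)) (u v : PWt) :
    entry (w ++ barWord l) u v = signWord l v * entry w u (reflWord l v) := by
  rw [entry, act_append, Module.End.mul_apply, act_barWord, map_smul]
  rfl

theorem twistWord_append_barWord (a : Fin 16 → ℂ) (l : List (Fin 6)) :
    twistWord (torusWord.subst a ++ barWord l) =
      torusWordTwist.subst a ++ barWord (l.map dynkinSymm) := by
  rw [twistWord, List.map_append]
  congr 1
  rw [barWord, List.map_flatMap, barWord, List.flatMap_map]
  rfl

/-- Transposition turns row `v0` of `u` into column `v0` of a product of factors `x_i`, the same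
matrix that occurs in the minors. -/
theorem p_torusElt (a : Fin 16 → ℂ) (v : PWt) :
    p v (torusElt a) = entry (torusWord.subst a) v .v0 := by
  rw [entry, ← toLin'_wordG, ← transpose_torusElt, Matrix.toLin'_apply, Matrix.mulVec_single_one]
  rfl

/-! ### Computation with polynomials -/

/-- A polynomial with integral coefficients in 16 variables: a list of coefficients and
monomials, which are lists of variables. -/
abbrev Poly : Type := List (ℤ × List (Fin 16))

namespace Poly

/-- The value of a monomial. -/
def evalMon (a : Fin 16 → ℂ) (s : List (Fin 16)) : ℂ := (s.map a).prod

/-- The value of a polynomial. -/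
def eval (a : Fin 16 → ℂ) : Poly → ℂ
  | [] => 0
  | t :: p => t.1 * evalMon a t.2 + eval a p

theorem eval_append (a : Fin 16 → ℂ) (p q : Poly) : eval a (p ++ q) = eval a p + eval a q := by
  induction p with
  | nil => simp [eval]
  | cons t p ih => simp only [List.cons_append, eval, ih, add_assoc]

/-- Multiplication by an integer. -/
def scale (c : ℤ) (p : Poly) : Poly := p.map fun t => (c * t.1, t.2)

theorem eval_scale (a : Fin 16 → ℂ) (c : ℤ) (p : Poly) : eval a (p.scale c) = c * eval a p := by
  induction p with
  | nil => simp [eval, scale]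
  | cons t p ih =>
    have : eval a (scale c (t :: p)) =
      ((c * t.1 : ℤ) : ℂ) * evalMon a t.2 + eval a (scale c p) := rfl
    rw [this, ih, eval]
    push_cast
    ring

/-- The product of two sorted monomials. -/
def mulMon (s t : List (Fin 16)) : List (Fin 16) := s.foldr (List.orderedInsert (· ≤ ·)) t

theorem evalMon_mulMon (a : Fin 16 → ℂ) (s t : List (Fin 16)) :
    evalMon a (mulMon s t) = evalMon a s * evalMon a t := by
  induction s with
  | nil => simp [mulMon, evalMon]
  | cons k s ih =>
    have h : mulMon (k :: s) t = (mulMon s t).orderedInsert (· ≤ ·) k := rfl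
    have h' : evalMon a (k :: s) = a k * evalMon a s := by simp [evalMon]
    rw [h, evalMon, ((List.perm_orderedInsert (· ≤ ·) k _).map a).prod_eq, List.map_cons,
      List.prod_cons, ← evalMon, ih, h', mul_assoc]

/-- The product of polynomials. -/
def mul (p q : Poly) : Poly :=
  p.flatMap fun s => q.map fun t => (s.1 * t.1, mulMon s.2 t.2)

theorem eval_mul (a : Fin 16 → ℂ) (p q : Poly) : eval a (p.mul q) = eval a p * eval a q := by
  induction p with
  | nil => simp [eval, mul]
  | cons s p ih =>
    have h : mul (s :: p) q = q.map (fun t => (s.1 * t.1, mulMon s.2 t.2)) ++ mul p q := rfl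
    rw [h, eval_append, ih, eval, add_mul]
    congr 1
    clear ih h
    induction q with
    | nil => simp [eval]
    | cons t q ih =>
      simp only [List.map_cons, eval, ih, evalMon_mulMon]
      push_cast
      ring

/-- The difference of polynomials. -/
def sub (p q : Poly) : Poly := p ++ q.scale (-1)

theorem eval_sub (a : Fin 16 → ℂ) (p q : Poly) : eval a (p.sub q) = eval a p - eval a q := by
  rw [sub, eval_append, eval_scale]
  push_cast
  ring

/-- The sum of polynomials. -/
def add (p q : Poly) : Poly := p ++ q

theorem eval_add (a : Fin 16 → ℂ) (p q : Poly) : eval a (p.add q) = eval a p + eval a q :=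
  eval_append a p q

/-- Adds a term to a polynomial, collecting equal monomials. -/
def insertTerm (t : ℤ × List (Fin 16)) : Poly → Poly
  | [] => [t]
  | t' :: p => if t.2 = t'.2 then (t.1 + t'.1, t'.2) :: p else t' :: insertTerm t p

theorem eval_insertTerm (a : Fin 16 → ℂ) (t : ℤ × List (Fin 16)) (p : Poly) :
    eval a (insertTerm t p) = t.1 * evalMon a t.2 + eval a p := by
  induction p with
  | nil => rfl
  | cons t' p ih =>
    rw [insertTerm]
    split_ifs with h
    · simp only [eval, h]
      push_cast
      ring
    · simp only [eval, ih]
      ring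

/-- Whether all coefficients of a polynomial vanish once equal monomials have been collected. -/
def isZero (p : Poly) : Bool := (p.foldr insertTerm []).all fun t => t.1 = 0

/-- Only soundness of the test is needed: that monomials are kept sorted affects whether equal ones
are recognized, not the truth of the conclusion. -/
theorem eval_eq_zero {p : Poly} (h : p.isZero) (a : Fin 16 → ℂ) : eval a p = 0 := by
  have h1 : ∀ p : Poly, eval a (p.foldr insertTerm []) = eval a p := by
    intro p
    induction p with
    | nil => rfl
    | cons t p ih => rw [List.foldr_cons, eval_insertTerm, ih, eval]
  have h2 : ∀ p : Poly, (p.all fun t => t.1 = 0) → eval a p = 0 := by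
    intro p hp
    induction p with
    | nil => rfl
    | cons t p ih =>
      rw [List.all_cons, Bool.and_eq_true, decide_eq_true_eq] at hp
      rw [eval, hp.1, ih hp.2]
      simp
  rw [← h1, h2 _ h]

theorem eval_eq_eval {p q : Poly} (h : (p.sub q).isZero) (a : Fin 16 → ℂ) :
    eval a p = eval a q := by
  rw [← sub_eq_zero, ← eval_sub, eval_eq_zero h]

end Poly

/-! ### Matrix entries and minors as polynomials in the torus parameters -/

/-- The polynomial that gives the matrix entry of a labelled word. -/
def pathPoly : LabelledWord → PWt → PWt → Poly
  | [], u, v => if u = v then [(1, [])] else []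
  | s :: l, u, v => pathPoly l u v ++
      match u.down s.1 with
      | none => []
      | some u' => (pathPoly l u' v).map fun t => (t.1, s.2 :: t.2)

theorem eMat_apply_eq_elim (i : Fin 6) (z : PWt → ℂ) (u : PWt) :
    Matrix.toLin' (eMat i) z u = (u.down i).elim 0 z := by
  simp only [Matrix.toLin'_apply, Matrix.mulVec, dotProduct, eMat, Matrix.of_apply,
    mem_hasseEdges_iff_down]
  rcases u.down i with _ | w
  · simp
  · simp

/-- Because `e_i` squares to zero, each letter either leaves the row index alone or moves it down
one edge at the cost of its parameter. The entry is the sum over the resulting paths from `u` to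
`v`. -/
theorem entry_subst (a : Fin 16 → ℂ) (l : LabelledWord) (u v : PWt) :
    entry (l.subst a) u v = (pathPoly l u v).eval a := by
  induction l generalizing u with
  | nil =>
    simp only [entry, LabelledWord.subst, List.map_nil, act_nil, Module.End.one_apply, pathPoly]
    by_cases h : u = v
    · simp [h, Poly.eval, Poly.evalMon]
    · simp [h, Poly.eval]
  | cons s l ih =>
    have h : entry (LabelledWord.subst a (s :: l)) u v =
        entry (LabelledWord.subst a l) u v +
          a s.2 * (u.down s.1).elim 0 fun u' => entry (LabelledWord.subst a l) u' v := by
      rw [entry, LabelledWord.subst, List.map_cons, act_cons, Module.End.mul_apply,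
        expo_of_sq_eq_zero]
      · exact congrArg (fun c => entry (LabelledWord.subst a l) u v + a s.2 * c)
          (eMat_apply_eq_elim s.1 (minuscule.act (LabelledWord.subst a l) (bvec v)) u)
      · have : minuscule.E s.1 * minuscule.E s.1 = 0 := by
          change Matrix.toLin' (eMat s.1) * Matrix.toLin' (eMat s.1) = 0
          rw [Module.End.mul_eq_comp, ← Matrix.toLin'_mul, eMat_mul_self, map_zero]
        simp [this]
    rw [h, pathPoly, Poly.eval_append, ih]
    congr 1
    rcases u.down s.1 with _ | u'
    · simp [Poly.eval]
    · rw [Option.elim_some, ih]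
      change _ = Poly.eval a ((pathPoly l u' v).map fun t => (t.1, s.2 :: t.2))
      generalize pathPoly l u' v = q
      induction q with
      | nil => simp [Poly.eval]
      | cons t q ihq =>
        simp only [Poly.eval, List.map_cons, mul_add, ihq, Poly.evalMon, List.prod_cons]
        ring

/-- The polynomial that gives the matrix entry of a labelled word times the representative of a
Weyl group element. -/
def minorPoly (w : LabelledWord) (l : List (Fin 6)) (u v : PWt) : Poly :=
  (pathPoly w u (reflWord l v)).scale (signWord l v)

theorem entry_subst_append_barWord (a : Fin 16 → ℂ) (w : LabelledWord) (l : List (Fin 6))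
    (u v : PWt) : entry (w.subst a ++ barWord l) u v = (minorPoly w l u v).eval a := by
  rw [entry_append_barWord, entry_subst, minorPoly, Poly.eval_scale]

/-- The polynomial of a Plücker coordinate. -/
def pPoly (v : PWt) : Poly := pathPoly torusWord v .v0

theorem p_torusElt_eq_eval (a : Fin 16 → ℂ) (v : PWt) : p v (torusElt a) = (pPoly v).eval a := by
  rw [p_torusElt, entry_subst, pPoly]

/-- The polynomial of a generalized minor for `ω₁` or `ω₆`. -/
def minorPolyOne (w : LabelledWord) (l : List (Fin 6)) : Poly := minorPoly w l .v16 .v16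

/-- The polynomial of a generalized minor for `ω₃` or `ω₅`. -/
def minorPolyTwo (w : LabelledWord) (l : List (Fin 6)) : Poly :=
  ((minorPoly w l .v16 .v16).mul (minorPoly w l .v15 .v15)).sub
    ((minorPoly w l .v16 .v15).mul (minorPoly w l .v15 .v16))

/-- The polynomial of a generalized minor for `ω₄`. -/
def minorPolyThree (w : LabelledWord) (l : List (Fin 6)) : Poly :=
  let q := minorPoly w l
  (((q .v16 .v16).mul (((q .v15 .v15).mul (q .v14 .v14)).sub
    ((q .v15 .v14).mul (q .v14 .v15)))).add
  ((q .v16 .v15).mul (((q .v15 .v14).mul (q .v14 .v16)).sub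
    ((q .v15 .v16).mul (q .v14 .v14))))).add
  ((q .v16 .v14).mul (((q .v15 .v16).mul (q .v14 .v15)).sub
    ((q .v15 .v15).mul (q .v14 .v16))))

/-- The polynomial of a generalized minor for `ω₂`. -/
def minorPolyAdjoint (w w' : LabelledWord) (l l' : List (Fin 6)) : Poly :=
  let q u u' := (minorPoly w l .v16 u).mul (minorPoly w' l' .v11b u')
  (((((q .v16 .v11b).sub (q .v15 .v12b)).add (q .v14 .v13)).sub (q .v13 .v14)).add
    (q .v12b .v15)).sub (q .v11b .v16)

section Variables

variable {V : Fin 6 → Type*} [∀ i, AddCommGroup (V i)] [∀ i, Module ℂ (V i)]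
  [∀ i, LieRingModule 𝔤 (V i)] [∀ i, LieModule ℂ 𝔤 (V i)]
  {ρ : ∀ i, Representation ℂ G (V i)} {v : ∀ i, V i}

theorem phi_fund_one (hV : ∀ i, IsFundamentalRep i (ρ i) (v i)) {m : ℕ} (hm : m ∈ seedIdx)
    (hj : dynkinSymm (r m) = 0) (a : Fin 16 → ℂ) : phi ρ v m (torusElt a) =
    (minorPolyOne torusWord (seedWord m)).eval a := by
  rw [phi_torusElt ρ v hm hj, hwCoeff_fund_one (hV 0)]
  rw [entry_subst_append_barWord, minorPolyOne]

theorem phi_fund_two (hV : ∀ i, IsFundamentalRep i (ρ i) (v i)) {m : ℕ} (hm : m ∈ seedIdx)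
    (hj : dynkinSymm (r m) = 1) (a : Fin 16 → ℂ) : phi ρ v m (torusElt a) =
    (minorPolyAdjoint torusWord torusWordTwist (seedWord m)
      ((seedWord m).map dynkinSymm)).eval a := by
  rw [phi_torusElt ρ v hm hj, hwCoeff_fund_two (hV 1)]
  simp only [twistWord_append_barWord, entry_subst_append_barWord, minorPolyAdjoint, Poly.eval_mul,
    Poly.eval_sub, Poly.eval_add]

theorem phi_fund_three (hV : ∀ i, IsFundamentalRep i (ρ i) (v i)) {m : ℕ} (hm : m ∈ seedIdx)
    (hj : dynkinSymm (r m) = 2) (a : Fin 16 → ℂ) : phi ρ v m (torusElt a) =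
    (minorPolyTwo torusWord (seedWord m)).eval a := by
  rw [phi_torusElt ρ v hm hj, hwCoeff_fund_three (hV 2)]
  simp only [entry_subst_append_barWord, minorPolyTwo, Poly.eval_mul, Poly.eval_sub]

theorem phi_fund_four (hV : ∀ i, IsFundamentalRep i (ρ i) (v i)) {m : ℕ} (hm : m ∈ seedIdx)
    (hj : dynkinSymm (r m) = 3) (a : Fin 16 → ℂ) : phi ρ v m (torusElt a) =
    (minorPolyThree torusWordTwist ((seedWord m).map dynkinSymm)).eval a := by
  rw [phi_torusElt ρ v hm hj, hwCoeff_fund_four (hV 3)]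
  simp only [twistWord_append_barWord, entry_subst_append_barWord, minorPolyThree, Poly.eval_mul,
    Poly.eval_sub, Poly.eval_add]

theorem phi_fund_five (hV : ∀ i, IsFundamentalRep i (ρ i) (v i)) {m : ℕ} (hm : m ∈ seedIdx)
    (hj : dynkinSymm (r m) = 4) (a : Fin 16 → ℂ) : phi ρ v m (torusElt a) =
    (minorPolyTwo torusWordTwist ((seedWord m).map dynkinSymm)).eval a := by
  rw [phi_torusElt ρ v hm hj, hwCoeff_fund_five (hV 4)]
  simp only [twistWord_append_barWord, entry_subst_append_barWord, minorPolyTwo, Poly.eval_mul,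
    Poly.eval_sub]

theorem phi_fund_six (hV : ∀ i, IsFundamentalRep i (ρ i) (v i)) {m : ℕ} (hm : m ∈ seedIdx)
    (hj : dynkinSymm (r m) = 5) (a : Fin 16 → ℂ) : phi ρ v m (torusElt a) =
    (minorPolyOne torusWordTwist ((seedWord m).map dynkinSymm)).eval a := by
  rw [phi_torusElt ρ v hm hj, hwCoeff_fund_six (hV 5)]
  rw [twistWord_append_barWord, entry_subst_append_barWord, minorPolyOne]

/-- The fundamental representation in use is that of `σ(r_m)`, which selects the model; what is left
in each case is an identity in ℤ[a₁, …, a₁₆]. -/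
theorem phi_torusElt_eq (hV : ∀ i, IsFundamentalRep i (ρ i) (v i)) (a : Fin 16 → ℂ) :
    phi ρ v 6 (torusElt a) = p .v3 (torusElt a) ∧
    phi ρ v 7 (torusElt a) = p .v2 (torusElt a) ∧
    phi ρ v 8 (torusElt a) = p .v1 (torusElt a) ∧
    phi ρ v 10 (torusElt a) = p .v4b (torusElt a) ∧
    phi ρ v 11 (torusElt a) = q8a (torusElt a) ∧
    phi ρ v 12 (torusElt a) = q8 (torusElt a) ∧
    phi ρ v 13 (torusElt a) = p .v4a (torusElt a) ∧
    phi ρ v 14 (torusElt a) = q15 (torusElt a) ∧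
    phi ρ v 15 (torusElt a) = q10 (torusElt a) ∧
    phi ρ v 16 (torusElt a) = p .v5b (torusElt a) ∧
    phi ρ v 17 (torusElt a) = q12 (torusElt a) ∧
    phi ρ v 18 (torusElt a) = q24 (torusElt a) ∧
    phi ρ v 19 (torusElt a) = q16 (torusElt a) ∧
    phi ρ v 20 (torusElt a) = p .v8 (torusElt a) ∧
    phi ρ v 21 (torusElt a) = q20 (torusElt a) ∧
    phi ρ v 42 (torusElt a) = p .v16 (torusElt a) := by
  simp only [q8, q8a, q10, q12, q15, q16, q20, q24, p_torusElt_eq_eval, ← Poly.eval_mul,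
    ← Poly.eval_sub, ← Poly.eval_add]
  refine ⟨?_, ?_, ?_, ?_, ?_, ?_, ?_, ?_, ?_, ?_, ?_, ?_, ?_, ?_, ?_, ?_⟩
  · exact phi_fund_four hV (m := 6) (by decide) (by decide +kernel) a
      |>.trans (Poly.eval_eq_eval (by decide +kernel) a)
  · exact phi_fund_five hV (m := 7) (by decide) (by decide +kernel) a
      |>.trans (Poly.eval_eq_eval (by decide +kernel) a)
  · exact phi_fund_six hV (m := 8) (by decide) (by decide +kernel) a
      |>.trans (Poly.eval_eq_eval (by decide +kernel) a)
  · exact phi_fund_three hV (m := 10) (by decide) (by decide +kernel) a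
      |>.trans (Poly.eval_eq_eval (by decide +kernel) a)
  · exact phi_fund_four hV (m := 11) (by decide) (by decide +kernel) a
      |>.trans (Poly.eval_eq_eval (by decide +kernel) a)
  · exact phi_fund_five hV (m := 12) (by decide) (by decide +kernel) a
      |>.trans (Poly.eval_eq_eval (by decide +kernel) a)
  · exact phi_fund_two hV (m := 13) (by decide) (by decide +kernel) a
      |>.trans (Poly.eval_eq_eval (by decide +kernel) a)
  · exact phi_fund_four hV (m := 14) (by decide) (by decide +kernel) a
      |>.trans (Poly.eval_eq_eval (by decide +kernel) a)
  · exact phi_fund_three hV (m := 15) (by decide) (by decide +kernel) a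
      |>.trans (Poly.eval_eq_eval (by decide +kernel) a)
  · exact phi_fund_one hV (m := 16) (by decide) (by decide +kernel) a
      |>.trans (Poly.eval_eq_eval (by decide +kernel) a)
  · exact phi_fund_two hV (m := 17) (by decide) (by decide +kernel) a
      |>.trans (Poly.eval_eq_eval (by decide +kernel) a)
  · exact phi_fund_four hV (m := 18) (by decide) (by decide +kernel) a
      |>.trans (Poly.eval_eq_eval (by decide +kernel) a)
  · exact phi_fund_five hV (m := 19) (by decide) (by decide +kernel) a
      |>.trans (Poly.eval_eq_eval (by decide +kernel) a)
  · exact phi_fund_six hV (m := 20) (by decide) (by decide +kernel) a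
      |>.trans (Poly.eval_eq_eval (by decide +kernel) a)
  · exact phi_fund_three hV (m := 21) (by decide) (by decide +kernel) a
      |>.trans (Poly.eval_eq_eval (by decide +kernel) a)
  · exact phi_fund_one hV (m := 42) (by decide) (by decide +kernel) a
      |>.trans (Poly.eval_eq_eval (by decide +kernel) a)

end Variables

end

noncomputable section

open ChevalleyRep

/-! ### The minors of weight `ω₆` at the identity -/

/-- The inverse of a word. -/
def invWord (w : Word) : Word := (w.map fun s => (s.1, s.2.1, -s.2.2)).reverse

theorem wordG_invWord (w : Word) : wordG (invWord w) = (wordG w)⁻¹ := by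
  have h : ∀ s : Bool × Fin 6 × ℂ, cond s.1 (x s.2.1 (-s.2.2)) (y s.2.1 (-s.2.2)) =
      (cond s.1 (x s.2.1 s.2.2) (y s.2.1 s.2.2))⁻¹ := by
    rintro ⟨_ | _, i, a⟩ <;> exact Subtype.ext (Units.ext rfl)
  rw [wordG, wordG, List.prod_inv_reverse, invWord, List.map_reverse, List.map_map, List.map_map]
  congr 2
  exact List.map_congr_left fun s _ => h s

theorem act_invWord_mul (w : Word) : minuscule.act (invWord w) * minuscule.act w = 1 := by
  rw [← toLin'_wordG, ← toLin'_wordG, Module.End.mul_eq_comp, ← Matrix.toLin'_mul,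
    wordG_invWord, ← Units.val_mul, ← Subgroup.coe_mul, inv_mul_cancel]
  exact Matrix.toLin'_one

theorem signWord_sq (l : List (Fin 6)) (v : PWt) : (signWord l v : ℂ) * signWord l v = 1 := by
  have h : signWord l v * signWord l v = 1 := by
    induction l with
    | nil => rfl
    | cons i l ih =>
      have hs : ∀ u : PWt, u.reflSign i * u.reflSign i = 1 := by
        intro u
        rw [PWt.reflSign]
        split_ifs <;> rfl
      rw [signWord, mul_mul_mul_comm, hs, ih, one_mul]
  exact_mod_cast h

/-- The inverse of a signed permutation matrix is its transpose. -/
theorem act_invWord_barWord_apply (l : List (Fin 6)) (hl : Function.Bijective (reflWord l))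
    (z : PWt → ℂ) (v : PWt) :
    minuscule.act (invWord (barWord l)) z v = signWord l v * z (reflWord l v) := by
  have h : coord v ∘ₗ minuscule.act (invWord (barWord l)) =
      (signWord l v : ℂ) • coord (reflWord l v) := by
    refine (Pi.basisFun ℂ PWt).ext fun u => ?_
    obtain ⟨u, rfl⟩ := hl.2 u
    have hu : minuscule.act (invWord (barWord l)) (bvec (reflWord l u)) =
        (signWord l u : ℂ) • bvec u := by
      have := congrArg (fun T => T (bvec u)) (act_invWord_mul (barWord l))
      simp only [Module.End.mul_apply, act_barWord, map_smul, Module.End.one_apply] at this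
      rw [← this, smul_smul, signWord_sq, one_smul]
    simp only [Pi.basisFun_apply, LinearMap.comp_apply, hu, LinearMap.smul_apply,
      LinearMap.proj_apply, Pi.smul_apply, smul_eq_mul, Pi.single_apply, hl.1.eq_iff]
    by_cases huv : v = u
    · simp [huv]
    · simp [huv]
  exact congrArg (fun T => T z) h

theorem reflWord_bijective (l : List (Fin 6)) : Function.Bijective (reflWord l) := by
  refine Finite.injective_iff_bijective.mp fun v w h => ?_
  induction l with
  | nil => exact h
  | cons i l ih =>
    have hi : ∀ (i : Fin 6) (v : PWt), (v.refl i).refl i = v := by decide +kernel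
    refine ih ?_
    rw [reflWord, reflWord] at h
    rw [← hi i (reflWord l v), h, hi]

/-- The sign enters once from each side and squares to 1, so conjugation merely relabels a diagonal
entry. -/
theorem entry_conj_barWord (w : Word) (l : List (Fin 6)) (v : PWt) :
    entry (invWord (barWord l) ++ (w ++ barWord l)) v v =
      entry w (reflWord l v) (reflWord l v) := by
  have h : entry (invWord (barWord l) ++ (w ++ barWord l)) v v =
      signWord l v * entry (w ++ barWord l) (reflWord l v) v := by
    rw [entry, act_append, Module.End.mul_apply,
      act_invWord_barWord_apply l (reflWord_bijective l)]
    rfl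
  rw [h, entry_append_barWord, ← mul_assoc, signWord_sq, one_mul]

theorem fMat_apply_eq_elim (i : Fin 6) (z : PWt → ℂ) (u : PWt) :
    Matrix.toLin' (fMat i) z u = (u.up i).elim 0 z := by
  simp only [Matrix.toLin'_apply, Matrix.mulVec, dotProduct, fMat, Matrix.of_apply,
    mem_hasseEdges_iff_up]
  rcases u.up i with _ | w
  · simp
  · simp

/-- Nothing is lowered to the highest weight, so the `v16` coordinate is never altered. -/
theorem entry_v16_of_lower {w : Word} (hw : ∀ s ∈ w, s.1 = false) :
    entry w .v16 .v16 = 1 := by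
  induction w with
  | nil => simp [entry]
  | cons s w ih =>
    rcases s with ⟨b, i, a⟩
    obtain rfl : b = false := hw _ List.mem_cons_self
    rw [← ih fun s hs => hw s (List.mem_cons_of_mem _ hs), entry, act_cons, Module.End.mul_apply,
      expo_of_sq_eq_zero]
    · have := fMat_apply_eq_elim i (minuscule.act w (bvec .v16)) .v16
      rw [up_v16] at this
      change entry w .v16 .v16 + a * Matrix.toLin' (fMat i) (minuscule.act w (bvec .v16)) .v16 = _
      rw [this]
      simp
    · have : minuscule.F i * minuscule.F i = 0 := by
        change Matrix.toLin' (fMat i) * Matrix.toLin' (fMat i) = 0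
        rw [Module.End.mul_eq_comp, ← Matrix.toLin'_mul, fMat_mul_self, map_zero]
      simp [this]

section Variables

variable {V : Fin 6 → Type*} [∀ i, AddCommGroup (V i)] [∀ i, Module ℂ (V i)]
  [∀ i, LieRingModule 𝔤 (V i)] [∀ i, LieModule ℂ 𝔤 (V i)]
  {ρ : ∀ i, Representation ℂ G (V i)} {v : ∀ i, V i}

/-- Here both sides are translated by `w₀`, which moves `v16` to `v0`; the minor is the diagonal
entry of `u^T` at `v0`. -/
theorem minorT_six_one_one (hV : ∀ i, IsFundamentalRep i (ρ i) (v i)) (a : Fin 16 → ℂ) :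
    minorT ρ v (node 6) 1 1 (torusElt a) = p .v0 (torusElt a) := by
  have h : minorT ρ v (node 6) 1 1 (torusElt a) =
      hwCoeff 0 (v 0) (ρ 0 ((bar (1 * w0))⁻¹ * transpose (torusElt a) * bar (1 * w0)) (v 0)) := rfl
  have hw : reflWord w0Word .v16 = .v0 := by decide +kernel
  rw [h, one_mul, bar_eq isReducedExpr_w0Word, transpose_torusElt, ← wordG_invWord, mul_assoc,
    ← wordG_append, ← wordG_append, hwCoeff_fund_one (hV 0), entry_conj_barWord, hw, p_torusElt]

/-- Both sides equal 1: `u` is a product of lowering exponentials, and the only path starting at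
`v0` is the empty one. -/
theorem minor_six_one_one (hV : ∀ i, IsFundamentalRep i (ρ i) (v i)) (a : Fin 16 → ℂ) :
    minor (node 6) (ρ (node 6)) (v (node 6)) 1 1 (torusElt a) = p .v0 (torusElt a) := by
  have h : minor (node 6) (ρ (node 6)) (v (node 6)) 1 1 (torusElt a) =
      hwCoeff 5 (v 5) (ρ 5 ((bar 1)⁻¹ * torusElt a * bar 1) (v 5)) := rfl
  have hu : torusElt a =
      wordG (List.ofFn fun k : Fin 16 => (false, r (k + 1), a k)).reverse := by
    rw [torusElt, wordG, List.map_reverse, List.map_ofFn]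
    rfl
  have hp : p .v0 (torusElt a) = 1 := by
    rw [p_torusElt_eq_eval, Poly.eval_eq_eval (q := [(1, [])]) (by decide +kernel)]
    simp [Poly.eval, Poly.evalMon]
  rw [h, hp, bar_one, inv_one, one_mul, mul_one, hu, hwCoeff_fund_six (hV 5), entry_v16_of_lower]
  intro s hs
  simp only [twistWord, List.mem_map, List.mem_reverse, List.mem_ofFn] at hs
  obtain ⟨_, ⟨k, rfl⟩, rfl⟩ := hs
  rfl

end Variables

/-! ### The quiver -/

theorem mutableIdx_eq : mutableIdx = {6, 7, 8, 10, 11, 12, 13, 14, 15, 16} := by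
  have h : ∀ m < 17, (1 ≤ m ∧ ∃ l < m, 1 ≤ l ∧ r l = r m) ↔
      m ∈ [6, 7, 8, 10, 11, 12, 13, 14, 15, 16] := by decide +kernel
  ext m
  simp only [mutableIdx, exchangeable, Set.mem_inter_iff, Set.mem_ofPred_eq]
  constructor
  · rintro ⟨hm, h1, -, l, hl, hlm, hr⟩
    simpa using (h m (by omega)).mp ⟨h1, l, hlm, hl, hr⟩
  · intro hm
    have hm' : m ∈ [6, 7, 8, 10, 11, 12, 13, 14, 15, 16] := by simpa using hm
    have hlt : m < 17 := by
      have : ∀ m ∈ [6, 7, 8, 10, 11, 12, 13, 14, 15, 16], m < 17 := by decide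
      exact this m hm'
    obtain ⟨h1, l, hlm, hl, hr⟩ := (h m hlt).mpr hm'
    exact ⟨by omega, h1, by omega, l, hl, hlm, hr⟩

theorem t_eq {i : Fin 6} {n : ℕ} (hi : i ≠ node 6)
    (h : 16 < n ∧ n ≤ 36 ∧ r n = i ∧ ∀ k < n, 16 < k → r k ≠ i) : t i = n := by
  rw [t, if_neg hi]
  refine IsLeast.csInf_eq ⟨⟨h.1, h.2.1, h.2.2.1⟩, fun k hk => ?_⟩
  by_contra hkn
  exact h.2.2.2 k (by omega) hk.1 hk.2.2

theorem t_values : t (node 1) = 20 ∧ t (node 2) = 17 ∧ t (node 3) = 19 ∧ t (node 4) = 18 ∧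
    t (node 5) = 21 ∧ t (node 6) = 42 :=
  ⟨t_eq (by decide) (by decide +kernel), t_eq (by decide) (by decide +kernel),
    t_eq (by decide) (by decide +kernel), t_eq (by decide) (by decide +kernel),
    t_eq (by decide) (by decide +kernel), if_pos rfl⟩

theorem mem_range_t {m : ℕ} : m ∈ Set.range t ↔ m ∈ [20, 17, 19, 18, 21, 42] := by
  obtain ⟨h1, h2, h3, h4, h5, h6⟩ := t_values
  constructor
  · rintro ⟨i, rfl⟩
    have : i = node 1 ∨ i = node 2 ∨ i = node 3 ∨ i = node 4 ∨ i = node 5 ∨ i = node 6 := by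
      revert i; decide
    rcases this with rfl | rfl | rfl | rfl | rfl | rfl <;> simp [h1, h2, h3, h4, h5, h6]
  · intro h
    simp only [List.mem_cons, List.not_mem_nil, or_false] at h
    rcases h with rfl | rfl | rfl | rfl | rfl | rfl
    exacts [⟨_, h1⟩, ⟨_, h2⟩, ⟨_, h3⟩, ⟨_, h4⟩, ⟨_, h5⟩, ⟨_, h6⟩]

/-- The index `m⁺`, or `0` if there is none. -/
def plus (m : ℕ) : ℕ := Nat.findGreatest (fun k => 1 ≤ k ∧ k < m ∧ r k = r m) 36

/-- `Nat.findGreatest` returns 0 when the set is empty, and 0 is not an index, so `1 ≤ l` separates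
the two cases. -/
theorem isPlus_iff {m l : ℕ} : IsPlus m l ↔ plus m = l ∧ 1 ≤ l := by
  rw [plus, Nat.findGreatest_eq_iff]
  constructor
  · rintro ⟨⟨h1, h2, h3, h4⟩, h5⟩
    refine ⟨⟨h2, fun _ => ⟨h1, h3, h4⟩, fun n hn hn' hk => ?_⟩, h1⟩
    have := h5 ⟨hk.1, hn', hk.2.1, hk.2.2⟩
    omega
  · rintro ⟨⟨h1, h2, h3⟩, h4⟩
    obtain ⟨-, h5, h6⟩ := h2 (by omega)
    refine ⟨⟨h4, h1, h5, h6⟩, fun k hk => ?_⟩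
    by_contra hlt
    exact h3 (by omega) hk.2.1 ⟨hk.1, hk.2.2.1, hk.2.2.2⟩

/-- The indices of the mutable variables. -/
def mutableList : List ℕ := [6, 7, 8, 10, 11, 12, 13, 14, 15, 16]

theorem mem_mutableIdx {m : ℕ} : m ∈ mutableIdx ↔ m ∈ mutableList := by
  rw [mutableIdx_eq]
  simp [mutableList]

theorem mem_vertices {m : ℕ} : m ∈ mutableIdx ∪ Set.range t ↔ m ∈ seedIdx := by
  rw [Set.mem_union, mem_mutableIdx, mem_range_t]
  simp only [mutableList, seedIdx, List.mem_cons, List.not_mem_nil, or_false]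
  tauto

/-- A decidable description of the arrows between two indices. -/
abbrev IndexArrow (a b : ℕ) : Prop :=
  (a ∈ mutableList ∨ b ∈ mutableList) ∧
    ((plus a = b ∧ 1 ≤ b) ∨ (a < b ∧ 1 ≤ plus a ∧ 1 ≤ plus b ∧ plus b < a ∧ plus a < plus b ∧
      cartan (r b) (r a) < 0))

theorem arrow_phi_phi_iff (a b : ℕ) :
    Arrow (.phi a) (.phi b) ↔ a ∈ seedIdx ∧ b ∈ seedIdx ∧ IndexArrow a b := by
  rw [Arrow, mem_vertices, mem_vertices, mem_mutableIdx, mem_mutableIdx]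
  simp only [isPlus_iff, IndexArrow, cartan]
  constructor
  · rintro ⟨ha, hb, hab, h | ⟨h1, _, _, ⟨rfl, h2⟩, ⟨rfl, h3⟩, h4⟩⟩
    · exact ⟨ha, hb, hab, .inl h⟩
    · exact ⟨ha, hb, hab, .inr ⟨h1, h2, h3, h4⟩⟩
  · rintro ⟨ha, hb, hab, h | ⟨h1, h2, h3, h4⟩⟩
    · exact ⟨ha, hb, hab, .inl h⟩
    · exact ⟨ha, hb, hab, .inr ⟨h1, _, _, ⟨rfl, h2⟩, ⟨rfl, h3⟩, h4⟩⟩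

theorem arrow_extra_phi_iff (m : ℕ) : Arrow .extra (.phi m) ↔ m = 8 := by
  have hl : ∀ l < 37, 1 ≤ l → r l = 0 → plus l = 0 → l = 1 := by decide +kernel
  have hm : ∀ m < 37, r m = 0 → plus m = 1 → m = 8 := by decide +kernel
  have h8 : r 8 = 0 ∧ plus 8 = 1 ∧ plus 1 = 0 := by decide +kernel
  rw [Arrow]
  change 1 ≤ m ∧ r m = 0 ∧ _ ↔ _
  constructor
  · rintro ⟨h1, hr, l, hlm, hk⟩
    have hl0 : plus l = 0 := by
      by_contra h
      exact hk _ (isPlus_iff.mpr ⟨rfl, by omega⟩)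
    obtain rfl : l = 1 := hl l (by have := hlm.1.2.1; omega) hlm.1.1 (hlm.1.2.2.2.trans hr) hl0
    by_cases hm37 : m < 37
    -- Beyond 36 the function `r` still takes the value 0, for instance at 37. Such an index has 8
    -- among its predecessors with the same letter, so its `m⁺` is at least 8 and cannot be 1.
    · exact hm m hm37 hr (isPlus_iff.mp hlm).1
    · have := hlm.2 (show (8 : ℕ) ∈ _ from
        ⟨by norm_num, by norm_num, by omega, h8.1.trans hr.symm⟩)
      omega
  · rintro rfl
    refine ⟨by norm_num, h8.1, 1, isPlus_iff.mpr ⟨h8.2.1, le_rfl⟩, fun k hk => ?_⟩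
    obtain ⟨h, h'⟩ := isPlus_iff.mp hk
    rw [h8.2.2] at h
    omega

theorem arrow_iff_mem_drawnArrows (a b : SeedVertex) : Arrow a b ↔ (a, b) ∈ drawnArrows := by
  rcases a with a | _ <;> rcases b with b | _
  · rw [arrow_phi_phi_iff]
    -- Restricting to the 16 numbered vertices turns the classification of arrows into a finite
    -- check on pairs.
    have h1 : ∀ a ∈ seedIdx, ∀ b ∈ seedIdx, IndexArrow a b →
        (SeedVertex.phi a, SeedVertex.phi b) ∈ drawnArrows := by decide +kernel
    constructor
    · rintro ⟨ha, hb, hab⟩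
      exact h1 a ha b hb hab
    · intro h
      simp only [drawnArrows, List.mem_append, List.mem_map, List.mem_singleton] at h
      rcases h with ⟨c, hc, h⟩ | h
      · have h2 : ∀ c ∈ ([(20, 8), (17, 13), (19, 12), (12, 7), (18, 14), (14, 11), (11, 6),
            (21, 15), (15, 10), (42, 16), (8, 12), (7, 11), (13, 14), (16, 21), (15, 18), (6, 13),
            (6, 10), (10, 11), (10, 16), (11, 12), (11, 15), (12, 20), (12, 14), (14, 19),
            (14, 17)] : List (ℕ × ℕ)), c.1 ∈ seedIdx ∧ c.2 ∈ seedIdx ∧ IndexArrow c.1 c.2 := by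
          decide +kernel
        cases h
        exact h2 c hc
      · cases h
  · refine iff_of_false id ?_
    simp [drawnArrows]
  · rw [arrow_extra_phi_iff]
    simp [drawnArrows]
  · refine iff_of_false id ?_
    simp [drawnArrows]

end

end CayleyPlane

theorem lemma4p1 {V : Fin 6 → Type*} [∀ i, AddCommGroup (V i)] [∀ i, Module ℂ (V i)]
    [∀ i, LieRingModule 𝔤 (V i)] [∀ i, LieModule ℂ 𝔤 (V i)]
    (ρ : ∀ i, Representation ℂ G (V i)) (v : ∀ i, V i)
    (hV : ∀ i, IsFundamentalRep i (ρ i) (v i)) :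
    -- the indices of the mutable and of the frozen variables
    mutableIdx = {6, 7, 8, 10, 11, 12, 13, 14, 15, 16} ∧
    (t (node 1) = 20 ∧ t (node 2) = 17 ∧ t (node 3) = 19 ∧ t (node 4) = 18 ∧ t (node 5) = 21 ∧
      t (node 6) = 42) ∧
    -- the variables in terms of Plücker coordinates
    (∀ u ∈ torusU,
      phi ρ v 6 u = p .v3 u ∧
      phi ρ v 7 u = p .v2 u ∧
      phi ρ v 8 u = p .v1 u ∧
      phi ρ v 10 u = p .v4b u ∧
      phi ρ v 11 u = q8a u ∧
      phi ρ v 12 u = q8 u ∧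
      phi ρ v 13 u = p .v4a u ∧
      phi ρ v 14 u = q15 u ∧
      phi ρ v 15 u = q10 u ∧
      phi ρ v 16 u = p .v5b u ∧
      phi ρ v 17 u = q12 u ∧
      phi ρ v 18 u = q24 u ∧
      phi ρ v 19 u = q16 u ∧
      phi ρ v 20 u = p .v8 u ∧
      phi ρ v 21 u = q20 u ∧
      phi ρ v 42 u = p .v16 u ∧
      minorT ρ v (node 6) 1 1 u = p .v0 u ∧
      minor (node 6) (ρ (node 6)) (v (node 6)) 1 1 u = p .v0 u) ∧
    -- the arrows of the quiver
    (∀ a b : SeedVertex, Arrow a b ↔ (a, b) ∈ drawnArrows) := by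
  refine ⟨mutableIdx_eq, t_values, ?_, arrow_iff_mem_drawnArrows⟩
  rintro _ ⟨a, -, rfl⟩
  obtain ⟨h6, h7, h8, h10, h11, h12, h13, h14, h15, h16, h17, h18, h19, h20, h21, h42⟩ :=
    phi_torusElt_eq (ρ := ρ) (v := v) hV a
  exact ⟨h6, h7, h8, h10, h11, h12, h13, h14, h15, h16, h17, h18, h19, h20, h21, h42,
    minorT_six_one_one hV a, minor_six_one_one hV a⟩
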